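/- Let $\mathbb K$ be a field and let $q^{1/2}\in\mathbb K$ be a nonzero element such that its square $q$ is not a root of unity. Let $\mathfrak{osp}_q(1|2)$ be the associative unital $\mathbb K$-algebra with generators $A_+,A_-,K,K^{-1},P$ and relations $$KA_\pm K^{-1}=q^{\pm1/2}A_\pm,\quad A_+A_-+A_-A_+=\frac{K^2-K^{-2}}{q^{1/2}-q^{-1/2}},\quad PA_\pm+A_\pm P=0,\quad [P,K]=[P,K^{-1}]=0,\quad KK^{-1}=K^{-1}K=1,\quad P^2=1,$$ with Casimir element $\Gamma^q=\Big(-A_+A_-+\frac{q^{-1/2}K^2-q^{1/2}K^{-2}}{q-q^{-1}}\Big)P$ and with the coproduct $\Delta$ (into the ordinary tensor square) given by $\Delta(A_\pm)=A_\pm\otimes KP+K^{-1}\otimes A_\pm$, $\Delta(K^{\pm1})=K^{\pm1}\otimes K^{\pm1}$, $\Delta(P)=P\otimes P$. Let $\mathcal I_R$ be the subalgebra generated by $A_+K$, $A_-K$, $K^2P$, $\Gamma^q$; then $\Delta(\mathcal I_R)\subset \mathfrak{osp}_q(1|2)\otimes\mathcal I_R$. Let $\tau_R:\mathcal I_R\to\mathfrak{osp}_q(1|2)\otimes\mathcal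 I_R$ be the algebra morphism with $$\tau_R(A_-K)=K^2P\otimes A_-K,\qquad \tau_R(K^2P)=1\otimes K^2P-(q-q^{-1})A_+K\otimes A_-K,\qquad \tau_R(\Gamma^q)=1\otimes\Gamma^q,$$ $$\tau_R(A_+K)=K^{-2}P\otimes A_+K+q^{-1/2}(q-q^{-1})A_+^2P\otimes A_-K+q^{-1/2}(q^{1/2}-q^{-1/2})A_+K^{-1}P\otimes K^2P+q^{-1/2}(q-q^{-1})A_+K^{-1}P\otimes\Gamma^q .$$ For $n\in\mathbb N$ and $A\subseteq\{1,\dots,n\}$ define $\Gamma^q_A\in\mathfrak{osp}_q(1|2)^{\otimes n}$ as follows. Put $\Gamma^q_\varnothing=-\frac{1}{q^{1/2}+q^{-1/2}}$. For $A=\{a_1<\dots<a_m\}$ with $m\ge1$ put $$\Gamma^q_A=1^{\otimes(a_1-1)}\otimes(\mu_m\cdots\mu_3\mu_2)(\Gamma^q)\otimes1^{\otimes(n-a_m)},$$ $$\mu_i=(1^{\otimes(a_i-a_1-1)}\otimes\tau_R)\cdots(1^{\otimes(a_{i-1}-a_1+1)}\otimes\tau_R)\,(1^{\otimes(a_{i-1}-a_1)}\otimes\Delta),$$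 where there are $a_i-a_{i-1}-1$ factors with $\tau_R$ (none if $a_i=a_{i-1}+1$). Write $\{X,Y\}_q=q^{1/2}XY+q^{-1/2}YX$. **Theorem 8.3 (higher rank $q$-Bannai–Ito relations).** Let $A_1,A_2,A_3,A_4$ be (possibly empty) subsets of $\{1,\dots,n\}$ such that, for all $i<j$, every element of $A_i$ is smaller than every element of $A_j$. If 1. $A=A_1\cup A_2\cup A_4$ and $B=A_2\cup A_3$, or 2. $A=A_2\cup A_3$ and $B=A_1\cup A_3\cup A_4$, or 3. $A=A_1\cup A_3\cup A_4$ and $B=A_1\cup A_2\cup A_4$, then $$\{\Gamma^q_A,\Gamma^q_B\}_q=\Gamma^q_{(A\cup B)\setminus(A\cap B)}+(q^{1/2}+q^{-1/2})\Big(\Gamma^q_{A\cap B}\,\Gamma^q_{A\cup B}+\Gamma^q_{A\setminus(A\cap B)}\,\Gamma^q_{B\setminus(A\cap B)}\Big).$$ -/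

import Mathlib

universe u

namespace QBI

set_option linter.unusedSimpArgs false

open scoped TensorProduct

/-- The generators `A_+`, `A_-`, `K`, `K⁻¹`, `P` of `osp_q(1|2)`. -/
inductive OspGen : Type
  | Ap | Am | K | Kinv | P

section
open FreeAlgebra OspGen

/-- The defining relations of `osp_q(1|2)`, where `s = q^{1/2}`. -/
inductive OspRel (k : Type*) [Field k] (s : k) :
    FreeAlgebra k OspGen → FreeAlgebra k OspGen → Prop
  | K_mul_Kinv : OspRel k s (ι k K * ι k Kinv) 1
  | Kinv_mul_K : OspRel k s (ι k Kinv * ι k K) 1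
  | K_conj_Ap : OspRel k s (ι k K * ι k Ap * ι k Kinv) (s • ι k Ap)
  | K_conj_Am : OspRel k s (ι k K * ι k Am * ι k Kinv) (s⁻¹ • ι k Am)
  | anticomm_Ap_Am : OspRel k s (ι k Ap * ι k Am + ι k Am * ι k Ap)
      ((s - s⁻¹)⁻¹ • (ι k K ^ 2 - ι k Kinv ^ 2))
  | anticomm_P_Ap : OspRel k s (ι k P * ι k Ap + ι k Ap * ι k P) 0
  | anticomm_P_Am : OspRel k s (ι k P * ι k Am + ι k Am * ι k P) 0
  | comm_P_K : OspRel k s (ι k P * ι k K - ι k K * ι k P) 0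
  | comm_P_Kinv : OspRel k s (ι k P * ι k Kinv - ι k Kinv * ι k P) 0
  | P_sq : OspRel k s (ι k P ^ 2) 1
end

/-- The quantum superalgebra `osp_q(1|2)` over the field `k`, with `s = q^{1/2}` and `q = s ^ 2`: the
associative algebra given by the generators and relations above. (The grading is implemented by
the generator `P`; tensor products of `osp_q(1|2)` are ordinary tensor products of algebras.) -/
def Osp (k : Type*) [Field k] (s : k) : Type _ := RingQuot (OspRel k s)

noncomputable section
variable {k : Type*} [Field k] (s : k)

instance : Ring (Osp k s) := inferInstanceAs (Ring (RingQuot (OspRel k s)))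
instance : Algebra k (Osp k s) := inferInstanceAs (Algebra k (RingQuot (OspRel k s)))

namespace Osp

/-- The quotient map from the free algebra. -/
def mk : FreeAlgebra k OspGen →ₐ[k] Osp k s := RingQuot.mkAlgHom k (OspRel k s)

theorem mk_rel {a b : FreeAlgebra k OspGen} (h : OspRel k s a b) : mk s a = mk s b :=
  RingQuot.mkAlgHom_rel k h

/-- The class of a generator. -/
def gen (g : OspGen) : Osp k s := mk s (FreeAlgebra.ι k g)

/-- The generator `A_+`. -/
def Ap : Osp k s := gen s .Ap
/-- The generator `A_-`. -/
def Am : Osp k s := gen s .Am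
/-- The generator `K`. -/
def K : Osp k s := gen s .K
/-- The generator `K⁻¹`. -/
def Kinv : Osp k s := gen s .Kinv
/-- The generator `P`. -/
def P : Osp k s := gen s .P

variable {s}
theorem K_mul_Kinv : K s * Kinv s = 1 := by
  simpa [Ap, Am, K, Kinv, P, gen] using mk_rel s (OspRel.K_mul_Kinv)
theorem Kinv_mul_K : Kinv s * K s = 1 := by
  simpa [Ap, Am, K, Kinv, P, gen] using mk_rel s (OspRel.Kinv_mul_K)
theorem K_conj_Ap : K s * Ap s * Kinv s = s • Ap s := by
  simpa [Ap, Am, K, Kinv, P, gen] using mk_rel s (OspRel.K_conj_Ap)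
theorem K_conj_Am : K s * Am s * Kinv s = s⁻¹ • Am s := by
  simpa [Ap, Am, K, Kinv, P, gen] using mk_rel s (OspRel.K_conj_Am)
theorem anticomm_Ap_Am : Ap s * Am s + Am s * Ap s = (s - s⁻¹)⁻¹ • (K s ^ 2 - Kinv s ^ 2) := by
  simpa [Ap, Am, K, Kinv, P, gen] using mk_rel s (OspRel.anticomm_Ap_Am)
theorem anticomm_P_Ap : P s * Ap s + Ap s * P s = 0 := by
  simpa [Ap, Am, K, Kinv, P, gen] using mk_rel s (OspRel.anticomm_P_Ap)
theorem anticomm_P_Am : P s * Am s + Am s * P s = 0 := by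
  simpa [Ap, Am, K, Kinv, P, gen] using mk_rel s (OspRel.anticomm_P_Am)
theorem comm_P_K : P s * K s - K s * P s = 0 := by
  simpa [Ap, Am, K, Kinv, P, gen] using mk_rel s (OspRel.comm_P_K)
theorem comm_P_Kinv : P s * Kinv s - Kinv s * P s = 0 := by
  simpa [Ap, Am, K, Kinv, P, gen] using mk_rel s (OspRel.comm_P_Kinv)
theorem P_sq : P s ^ 2 = 1 := by
  simpa [Ap, Am, K, Kinv, P, gen] using mk_rel s (OspRel.P_sq)

/-- The images `ap`, `am`, `c`, `ci`, `p` of the generators satisfy the defining relations. -/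
structure Relations {B : Type*} [Ring B] [Algebra k B] (s : k) (ap am c ci p : B) : Prop where
  h1 : c * ci = 1
  h2 : ci * c = 1
  h3 : c * ap * ci = s • ap
  h4 : c * am * ci = s⁻¹ • am
  h5 : ap * am + am * ap = (s - s⁻¹)⁻¹ • (c ^ 2 - ci ^ 2)
  h6 : p * ap + ap * p = 0
  h7 : p * am + am * p = 0
  h8 : p * c - c * p = 0
  h9 : p * ci - ci * p = 0
  h10 : p ^ 2 = 1

theorem Relations.of_and {B : Type*} [Ring B] [Algebra k B] {ap am c ci p : B}
    (h : c * ci = 1 ∧ ci * c = 1 ∧ c * ap * ci = s • ap ∧ c * am * ci = s⁻¹ • am ∧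
      ap * am + am * ap = (s - s⁻¹)⁻¹ • (c ^ 2 - ci ^ 2) ∧
      p * ap + ap * p = 0 ∧ p * am + am * p = 0 ∧
      p * c - c * p = 0 ∧ p * ci - ci * p = 0 ∧ p ^ 2 = 1) : Relations s ap am c ci p := by
  obtain ⟨h1, h2, h3, h4, h5, h6, h7, h8, h9, h10⟩ := h
  exact ⟨h1, h2, h3, h4, h5, h6, h7, h8, h9, h10⟩

/-- The algebra morphism out of `osp_q(1|2)` with prescribed images of the generators. -/
def lift {B : Type*} [Ring B] [Algebra k B] (ap am c ci p : B)
    (h : Relations s ap am c ci p) : Osp k s →ₐ[k] B :=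
  RingQuot.liftAlgHom k ⟨FreeAlgebra.lift k (fun
    | .Ap => ap | .Am => am | .K => c | .Kinv => ci | .P => p), by
    obtain ⟨h1, h2, h3, h4, h5, h6, h7, h8, h9, h10⟩ := h
    intro x y h
    cases h <;> simpa⟩

theorem lift_gens {B : Type*} [Ring B] [Algebra k B] (ap am c ci p : B)
    (h : Relations s ap am c ci p) :
    lift ap am c ci p h (Ap s) = ap ∧ lift ap am c ci p h (Am s) = am ∧
    lift ap am c ci p h (K s) = c ∧ lift ap am c ci p h (Kinv s) = ci ∧
    lift ap am c ci p h (P s) = p := by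
  refine ⟨?_, ?_, ?_, ?_, ?_⟩ <;>
  exact (RingQuot.liftAlgHom_mkAlgHom_apply k _ _ _).trans (FreeAlgebra.lift_ι_apply _ _)

theorem KA : K s * Ap s = s • (Ap s * K s) := by
  have := congrArg (· * K s) (K_conj_Ap (s := s))
  simpa [mul_assoc, Kinv_mul_K] using this
theorem KM : K s * Am s = s⁻¹ • (Am s * K s) := by
  have := congrArg (· * K s) (K_conj_Am (s := s))
  simpa [mul_assoc, Kinv_mul_K] using this
theorem kA (hs : s ≠ 0) : Kinv s * Ap s = s⁻¹ • (Ap s * Kinv s) := by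
  have := congrArg (Kinv s * ·) (K_conj_Ap (s := s))
  simp only [← mul_assoc, Kinv_mul_K, mul_smul_comm, one_mul] at this
  rw [this, inv_smul_smul₀ hs]
theorem kM (hs : s ≠ 0) : Kinv s * Am s = s • (Am s * Kinv s) := by
  have := congrArg (Kinv s * ·) (K_conj_Am (s := s))
  simp only [← mul_assoc, Kinv_mul_K, mul_smul_comm, one_mul] at this
  rw [this, smul_inv_smul₀ hs]
theorem PA : P s * Ap s = - (Ap s * P s) := eq_neg_of_add_eq_zero_left anticomm_P_Ap
theorem PM : P s * Am s = - (Am s * P s) := eq_neg_of_add_eq_zero_left anticomm_P_Am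
theorem PK : P s * K s = K s * P s := sub_eq_zero.1 comm_P_K
theorem Pk : P s * Kinv s = Kinv s * P s := sub_eq_zero.1 comm_P_Kinv
theorem PP : P s * P s = 1 := by rw [← sq, P_sq]
theorem MA : Am s * Ap s = (s - s⁻¹)⁻¹ • (K s * K s - Kinv s * Kinv s) - Ap s * Am s := by
  rw [← sq, ← sq, ← anticomm_Ap_Am]; abel

section assoc
variable (w : Osp k s)
theorem KA' : K s * (Ap s * w) = s • (Ap s * (K s * w)) := by
  rw [← mul_assoc, KA, smul_mul_assoc, mul_assoc]
theorem KM' : K s * (Am s * w) = s⁻¹ • (Am s * (K s * w)) := by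
  rw [← mul_assoc, KM, smul_mul_assoc, mul_assoc]
theorem kA' (hs : s ≠ 0) : Kinv s * (Ap s * w) = s⁻¹ • (Ap s * (Kinv s * w)) := by
  rw [← mul_assoc, kA hs, smul_mul_assoc, mul_assoc]
theorem kM' (hs : s ≠ 0) : Kinv s * (Am s * w) = s • (Am s * (Kinv s * w)) := by
  rw [← mul_assoc, kM hs, smul_mul_assoc, mul_assoc]
theorem PA' : P s * (Ap s * w) = - (Ap s * (P s * w)) := by
  rw [← mul_assoc, PA, neg_mul, mul_assoc]
theorem PM' : P s * (Am s * w) = - (Am s * (P s * w)) := by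
  rw [← mul_assoc, PM, neg_mul, mul_assoc]
theorem PK' : P s * (K s * w) = K s * (P s * w) := by rw [← mul_assoc, PK, mul_assoc]
theorem Pk' : P s * (Kinv s * w) = Kinv s * (P s * w) := by rw [← mul_assoc, Pk, mul_assoc]
theorem PP' : P s * (P s * w) = w := by rw [← mul_assoc, PP, one_mul]
theorem Kk' : K s * (Kinv s * w) = w := by rw [← mul_assoc, K_mul_Kinv, one_mul]
theorem kK' : Kinv s * (K s * w) = w := by rw [← mul_assoc, Kinv_mul_K, one_mul]
theorem MA' : Am s * (Ap s * w) =
    (s - s⁻¹)⁻¹ • (K s * (K s * w) - Kinv s * (Kinv s * w)) - Ap s * (Am s * w) := by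
  rw [← mul_assoc, MA, sub_mul, smul_mul_assoc, sub_mul, mul_assoc, mul_assoc, mul_assoc]
end assoc

variable (s) in
/-- The Casimir element `Γ^q = (-A_+ A_- + (q^{-1/2} K² - q^{1/2} K⁻²) / (q - q⁻¹)) P`. -/
def casimir : Osp k s :=
  (-(Ap s * Am s) + (s ^ 2 - (s ^ 2)⁻¹)⁻¹ • (s⁻¹ • K s ^ 2 - s • Kinv s ^ 2)) * P s

end Osp

/-- The parameter `s = q^{1/2}` is nonzero and `q = s ^ 2` is not a root of unity. -/
structure IsGeneric (s : k) : Prop where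
  ne_zero : s ≠ 0
  not_root_of_unity : ∀ m : ℕ, 0 < m → (s ^ 2) ^ m ≠ 1

variable {s}

theorem IsGeneric.h1 (h : IsGeneric s) : s ^ 2 - 1 ≠ 0 := by
  simpa [sub_eq_zero] using h.2 1 one_pos
theorem IsGeneric.h2 (h : IsGeneric s) : s ^ 2 + 1 ≠ 0 := by
  intro h0
  apply h.2 2 two_pos
  linear_combination (s ^ 2 - 1) * h0
theorem IsGeneric.e1 (h : IsGeneric s) : (s - s⁻¹)⁻¹ = s / (s ^ 2 - 1) := by
  have := h.1; have := h.h1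
  rw [inv_eq_one_div, div_eq_div_iff]
  · field_simp
  · intro h0; field_simp at h0; exact h.h1 (by linear_combination h0)
  · exact h.h1
theorem IsGeneric.e2 (h : IsGeneric s) :
    (s ^ 2 - (s ^ 2)⁻¹)⁻¹ = s ^ 2 / ((s ^ 2 - 1) * (s ^ 2 + 1)) := by
  have := h.1; have := h.h1; have := h.h2
  rw [inv_eq_one_div, div_eq_div_iff]
  · field_simp; ring
  · intro h0; field_simp at h0
    exact mul_ne_zero h.h1 h.h2 (by linear_combination h0)
  · exact mul_ne_zero h.h1 h.h2

open Osp Algebra.TensorProduct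

theorem casimir_comm (h : IsGeneric s) (g : OspGen) : casimir s * gen s g = gen s g * casimir s := by
  have hs := h.1; have := h.h1; have := h.h2
  rcases g with _ | _ | _ | _ | _
  all_goals
    try simp only [casimir, h.e2]
    simp only [h.e1, ← Ap.eq_1, ← Am.eq_1, ← K.eq_1, ← Kinv.eq_1, ← P.eq_1, sq, mul_add, add_mul,
      mul_sub, sub_mul, smul_mul_assoc, mul_smul_comm, mul_assoc, smul_sub, smul_add, neg_mul,
      mul_neg, smul_neg, smul_smul, neg_neg, sub_neg_eq_add, mul_one, one_mul, one_def,
      KA, KM, kA hs, kM hs, PA, PM, PK, Pk, PP, MA, K_mul_Kinv, Kinv_mul_K,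
      KA', KM', kA' _ hs, kM' _ hs, PA', PM', PK', Pk', PP', MA', Kk', kK']
    all_goals match_scalars
    all_goals try field_simp
    all_goals try ring

/-- Commutation rules in `osp_q(1|2) ⊗ osp_q(1|2)`, needed to construct `τ_R`. -/
theorem tens_rules (h : IsGeneric s) :
    let X := K s ^ 2 * P s
    let Xi := Kinv s ^ 2 * P s
    let x := K s ^ 2 * P s
    let y := Am s * K s
    let z := Ap s * K s
    let U := Ap s * Kinv s * P s
    let ξ := z ⊗ₜ[k] (Am s * Kinv s * P s)
    let D₁ := (s ^ 2)⁻¹ • (U ⊗ₜ[k] x)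
    let D₂ := ((s ^ 2)⁻¹ * (s + s⁻¹)) • (U ⊗ₜ[k] casimir s)
    (X ⊗ₜ[k] y) * ξ = ξ * (X ⊗ₜ[k] y) ∧
    ((1 : Osp k s) ⊗ₜ[k] x) * ξ = (-(s ^ 2)⁻¹) • (ξ * ((1 : Osp k s) ⊗ₜ[k] x)) ∧
    z ⊗ₜ[k] y = ξ * ((1 : Osp k s) ⊗ₜ[k] x) ∧
    (Xi ⊗ₜ[k] z) * ξ = ξ * (Xi ⊗ₜ[k] z) + (D₁ + D₂) ∧
    D₁ * ξ = ((s ^ 2)⁻¹ ^ 2) • (ξ * D₁) ∧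
    D₂ * ξ = (-(s ^ 2)⁻¹) • (ξ * D₂) ∧
    (Ap s ^ 2 * P s) ⊗ₜ[k] y = s • (ξ * D₁) := by
  have hs := h.1; have := h.h1; have := h.h2
  intro X Xi x y z U ξ D₁ D₂
  simp only [X, Xi, x, y, z, U, ξ, D₁, D₂]
  refine ⟨?_, ?_, ?_, ?_, ?_, ?_, ?_⟩
  all_goals
    try simp only [casimir, h.e2]
    simp only [h.e1, tmul_mul_tmul, sq, mul_add, add_mul,
      mul_sub, sub_mul, smul_mul_assoc, mul_smul_comm, mul_assoc, smul_sub, smul_add, neg_mul,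
      mul_neg, smul_neg, smul_smul, neg_neg, sub_neg_eq_add, mul_one, one_mul, one_def,
      KA, KM, kA hs, kM hs, PA, PM, PK, Pk, PP, MA, K_mul_Kinv, Kinv_mul_K,
      KA', KM', kA' _ hs, kM' _ hs, PA', PM', PK', Pk', PP', MA', Kk', kK',
      TensorProduct.tmul_add, TensorProduct.add_tmul, TensorProduct.tmul_sub,
      TensorProduct.sub_tmul, TensorProduct.tmul_neg, TensorProduct.neg_tmul,
      ← TensorProduct.smul_tmul', TensorProduct.tmul_smul]
    all_goals match_scalars
    all_goals try field_simp
    all_goals try ring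

theorem coproduct_relations (h : IsGeneric s) :
    Relations s (Ap s ⊗ₜ[k] (K s * P s) + Kinv s ⊗ₜ[k] Ap s)
      (Am s ⊗ₜ[k] (K s * P s) + Kinv s ⊗ₜ[k] Am s)
      (K s ⊗ₜ[k] K s) (Kinv s ⊗ₜ[k] Kinv s) (P s ⊗ₜ[k] P s) := by
  have hs := h.1; have := h.h1; have := h.h2
  constructor
  all_goals
    try simp only [casimir, h.e2]
    simp only [h.e1, tmul_mul_tmul, sq, mul_add, add_mul,
      mul_sub, sub_mul, smul_mul_assoc, mul_smul_comm, mul_assoc, smul_sub, smul_add, neg_mul,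
      mul_neg, smul_neg, smul_smul, neg_neg, sub_neg_eq_add, mul_one, one_mul, one_def,
      KA, KM, kA hs, kM hs, PA, PM, PK, Pk, PP, MA, K_mul_Kinv, Kinv_mul_K,
      KA', KM', kA' _ hs, kM' _ hs, PA', PM', PK', Pk', PP', MA', Kk', kK',
      TensorProduct.tmul_add, TensorProduct.add_tmul, TensorProduct.tmul_sub,
      TensorProduct.sub_tmul, TensorProduct.tmul_neg, TensorProduct.neg_tmul,
      ← TensorProduct.smul_tmul', TensorProduct.tmul_smul]
    all_goals match_scalars
    all_goals try field_simp
    all_goals try ring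

/-- The coproduct of `osp_q(1|2)`: `Δ(A_±) = A_± ⊗ K P + K⁻¹ ⊗ A_±`, `Δ(K^{±1}) = K^{±1} ⊗ K^{±1}`,
`Δ(P) = P ⊗ P`. -/
def coproduct (h : IsGeneric s) : Osp k s →ₐ[k] Osp k s ⊗[k] Osp k s :=
  Osp.lift
    (Ap s ⊗ₜ[k] (K s * P s) + Kinv s ⊗ₜ[k] Ap s)
    (Am s ⊗ₜ[k] (K s * P s) + Kinv s ⊗ₜ[k] Am s)
    (K s ⊗ₜ[k] K s) (Kinv s ⊗ₜ[k] Kinv s) (P s ⊗ₜ[k] P s)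
    (coproduct_relations h)

theorem coproduct_gens (h : IsGeneric s) :
    coproduct h (Ap s) = Ap s ⊗ₜ[k] (K s * P s) + Kinv s ⊗ₜ[k] Ap s ∧
    coproduct h (Am s) = Am s ⊗ₜ[k] (K s * P s) + Kinv s ⊗ₜ[k] Am s ∧
    coproduct h (K s) = K s ⊗ₜ[k] K s ∧ coproduct h (Kinv s) = Kinv s ⊗ₜ[k] Kinv s ∧
    coproduct h (P s) = P s ⊗ₜ[k] P s :=
  lift_gens _ _ _ _ _ (coproduct_relations h)

theorem coproduct_formulas (h : IsGeneric s) :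
    let ap := Ap s ⊗ₜ[k] (K s * P s) + Kinv s ⊗ₜ[k] Ap s
    let am := Am s ⊗ₜ[k] (K s * P s) + Kinv s ⊗ₜ[k] Am s
    let c := K s ⊗ₜ[k] K s
    let ci := Kinv s ⊗ₜ[k] Kinv s
    let p := P s ⊗ₜ[k] P s
    ap * c = (Ap s * K s) ⊗ₜ[k] (K s ^ 2 * P s) + 1 ⊗ₜ[k] (Ap s * K s) ∧
    am * c = (Am s * K s) ⊗ₜ[k] (K s ^ 2 * P s) + 1 ⊗ₜ[k] (Am s * K s) ∧
    c ^ 2 * p = (K s ^ 2 * P s) ⊗ₜ[k] (K s ^ 2 * P s) ∧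
    (-(ap * am) + (s ^ 2 - (s ^ 2)⁻¹)⁻¹ • (s⁻¹ • c ^ 2 - s • ci ^ 2)) * p =
      casimir s ⊗ₜ[k] (K s ^ 2 * P s) + (Kinv s ^ 2 * P s) ⊗ₜ[k] casimir s
      + ((s ^ 2 - (s ^ 2)⁻¹)⁻¹ * (s - s⁻¹)) • ((Kinv s ^ 2 * P s) ⊗ₜ[k] (K s ^ 2 * P s))
      + s⁻¹ • ((Ap s * Kinv s * P s) ⊗ₜ[k] (Am s * K s))
      - s • ((Am s * Kinv s * P s) ⊗ₜ[k] (Ap s * K s)) := by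
  have hs := h.1; have := h.h1; have := h.h2
  intro ap am c ci p
  simp only [ap, am, c, ci, p]
  refine ⟨?_, ?_, ?_, ?_⟩
  all_goals
    try simp only [casimir, h.e2]
    simp only [h.e1, tmul_mul_tmul, sq, mul_add, add_mul,
      mul_sub, sub_mul, smul_mul_assoc, mul_smul_comm, mul_assoc, smul_sub, smul_add, neg_mul,
      mul_neg, smul_neg, smul_smul, neg_neg, sub_neg_eq_add, mul_one, one_mul, one_def,
      KA, KM, kA hs, kM hs, PA, PM, PK, Pk, PP, MA, K_mul_Kinv, Kinv_mul_K,
      KA', KM', kA' _ hs, kM' _ hs, PA', PM', PK', Pk', PP', MA', Kk', kK',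
      TensorProduct.tmul_add, TensorProduct.add_tmul, TensorProduct.tmul_sub,
      TensorProduct.sub_tmul, TensorProduct.tmul_neg, TensorProduct.neg_tmul,
      ← TensorProduct.smul_tmul', TensorProduct.tmul_smul]
    all_goals match_scalars
    all_goals try field_simp
    all_goals try ring

/-- The subalgebra `I_R` of `osp_q(1|2)` generated by `A_+ K`, `A_- K`, `K² P` and `Γ^q`. -/
def IR (s : k) : Subalgebra k (Osp k s) :=
  Algebra.adjoin k {Ap s * K s, Am s * K s, K s ^ 2 * P s, casimir s}

namespace IR
variable (s)
/-- The element `A_+ K` of `I_R`. -/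
def ApK : IR s := ⟨Ap s * K s, Algebra.subset_adjoin (by simp)⟩
/-- The element `A_- K` of `I_R`. -/
def AmK : IR s := ⟨Am s * K s, Algebra.subset_adjoin (by simp)⟩
/-- The element `K² P` of `I_R`. -/
def KsqP : IR s := ⟨K s ^ 2 * P s, Algebra.subset_adjoin (by simp)⟩
/-- The element `Γ^q` of `I_R`. -/
def cas : IR s := ⟨casimir s, Algebra.subset_adjoin (by simp)⟩
end IR

theorem IR.hom_ext {B : Type*} [Ring B] [Algebra k B] {f g : IR s →ₐ[k] B}
    (h1 : f (ApK s) = g (ApK s)) (h2 : f (AmK s) = g (AmK s)) (h3 : f (KsqP s) = g (KsqP s))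
    (h4 : f (cas s) = g (cas s)) : f = g := by
  apply AlgHom.adjoin_ext
  intro x hx
  simp only [Set.mem_insert_iff, Set.mem_singleton_iff] at hx
  rcases hx with rfl | rfl | rfl | rfl
  exacts [h1, h2, h3, h4]

/-- The inclusion of `osp_q(1|2) ⊗ I_R` into `osp_q(1|2) ⊗ osp_q(1|2)`. -/
def inclIR (s : k) : Osp k s ⊗[k] IR s →ₐ[k] Osp k s ⊗[k] Osp k s :=
  Algebra.TensorProduct.map (AlgHom.id k (Osp k s)) (IR s).val

theorem inclIR_injective : Function.Injective (inclIR s) := by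
  have : Function.Injective (LinearMap.lTensor (Osp k s) (IR s).val.toLinearMap) :=
    Module.Flat.lTensor_preserves_injective_linearMap _ Subtype.val_injective
  exact this

theorem exists_lift_inclIR (f : IR s →ₐ[k] Osp k s ⊗[k] Osp k s)
    (h1 : f (IR.ApK s) ∈ (inclIR s).range) (h2 : f (IR.AmK s) ∈ (inclIR s).range)
    (h3 : f (IR.KsqP s) ∈ (inclIR s).range) (h4 : f (IR.cas s) ∈ (inclIR s).range) :
    ∃ g : IR s →ₐ[k] Osp k s ⊗[k] IR s, (inclIR s).comp g = f := by
  have hf (u : IR s) : f u ∈ (inclIR s).range := by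
    obtain ⟨u, hu⟩ := u
    induction hu using Algebra.adjoin_induction with
    | mem x hx =>
      simp only [Set.mem_insert_iff, Set.mem_singleton_iff] at hx
      rcases hx with rfl | rfl | rfl | rfl
      exacts [h1, h2, h3, h4]
    | algebraMap r =>
      have : f ⟨algebraMap k _ r, (IR s).algebraMap_mem r⟩ = algebraMap k _ r := f.commutes r
      rw [this]; exact Subalgebra.algebraMap_mem _ r
    | add x y hx hy ihx ihy =>
      have : f ⟨x + y, add_mem hx hy⟩ = f ⟨x, hx⟩ + f ⟨y, hy⟩ := map_add f ⟨x, hx⟩ ⟨y, hy⟩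
      rw [this]; exact add_mem ihx ihy
    | mul x y hx hy ihx ihy =>
      have : f ⟨x * y, mul_mem hx hy⟩ = f ⟨x, hx⟩ * f ⟨y, hy⟩ := map_mul f ⟨x, hx⟩ ⟨y, hy⟩
      rw [this]; exact mul_mem ihx ihy
  let e := AlgEquiv.ofInjective (inclIR s) inclIR_injective
  refine ⟨e.symm.toAlgHom.comp (f.codRestrict _ hf), AlgHom.ext fun u => ?_⟩
  have := congrArg Subtype.val (e.apply_symm_apply (f.codRestrict _ hf u))
  exact this

/-- The prescribed values of the coaction `τ_R : I_R → osp_q(1|2) ⊗ I_R` on the generators of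
`I_R`. -/
structure IsTauR (τ : IR s →ₐ[k] Osp k s ⊗[k] IR s) : Prop where
  AmK : τ (IR.AmK s) = (K s ^ 2 * P s) ⊗ₜ IR.AmK s
  ApK : τ (IR.ApK s) = (Kinv s ^ 2 * P s) ⊗ₜ IR.ApK s
    + (s⁻¹ * (s ^ 2 - (s ^ 2)⁻¹)) • ((Ap s ^ 2 * P s) ⊗ₜ IR.AmK s)
    + (s⁻¹ * (s - s⁻¹)) • ((Ap s * Kinv s * P s) ⊗ₜ IR.KsqP s)
    + (s⁻¹ * (s ^ 2 - (s ^ 2)⁻¹)) • ((Ap s * Kinv s * P s) ⊗ₜ IR.cas s)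
  KsqP : τ (IR.KsqP s) = 1 ⊗ₜ IR.KsqP s - (s ^ 2 - (s ^ 2)⁻¹) • ((Ap s * K s) ⊗ₜ IR.AmK s)
  cas : τ (IR.cas s) = 1 ⊗ₜ IR.cas s

/-! ### Existence of the coaction `τ_R` and of the restricted coproduct -/

section
variable {k : Type*} [Field k] {H C : Type*} [Ring H] [Algebra k H] [Ring C] [Algebra k C]

/-- Laurent polynomials inside Laurent series. -/
def toSeries (k C : Type*) [Field k] [Ring C] [Algebra k C] :
    AddMonoidAlgebra C ℤ →ₐ[k] HahnSeries ℤ C :=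
  AddMonoidAlgebra.liftNCAlgHom
    { (HahnSeries.C : C →+* HahnSeries ℤ C) with
      commutes' := fun _ => rfl }
    { toFun := fun n => HahnSeries.single n.toAdd (1 : C)
      map_one' := rfl
      map_mul' := fun a b => by simp }
    (fun x y => by
      show HahnSeries.C x * _ = _ * HahnSeries.C x
      simp)

theorem toSeries_single (n : ℤ) (a : C) :
    toSeries k C (AddMonoidAlgebra.single n a) = HahnSeries.single n a := by
  rw [toSeries, AddMonoidAlgebra.coe_liftNCAlgHom, AddMonoidAlgebra.liftNC_single]
  show HahnSeries.C a * HahnSeries.single n 1 = _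
  rw [HahnSeries.C_apply, HahnSeries.single_mul_single, zero_add, mul_one]

theorem toSeries_coeff (v : AddMonoidAlgebra C ℤ) (n : ℤ) :
    (toSeries k C v).coeff n = v.coeff n := by
  induction v using AddMonoidAlgebra.induction_linear with
  | zero => simp
  | add f g hf hg => simp [hf, hg]
  | single m a =>
    rw [toSeries_single, HahnSeries.coeff_single, AddMonoidAlgebra.coeff_single,
      Finsupp.single_apply]
    by_cases h : n = m
    · rw [if_pos h, if_pos h.symm]
    · rw [if_neg h, if_neg (Ne.symm h)]

/-- Evaluation of Laurent polynomials at `1`. -/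
def evalOne (k C : Type*) [Field k] [Ring C] [Algebra k C] :
    AddMonoidAlgebra C ℤ →ₐ[k] C :=
  AddMonoidAlgebra.liftNCAlgHom (AlgHom.id k C) 1 (fun x _ => Commute.one_right (AlgHom.id k C x))

theorem evalOne_single (n : ℤ) (a : C) :
    evalOne k C (AddMonoidAlgebra.single n a) = a := by
  rw [evalOne, AddMonoidAlgebra.coe_liftNCAlgHom, AddMonoidAlgebra.liftNC_single]
  simp

theorem exists_hom_of_intertwiner (j : H →ₐ[k] AddMonoidAlgebra C ℤ)
    (Θ : HahnSeries ℤ C) (h3 : Θ.coeff 0 = 1) (hneg : ∀ n : ℤ, n < 0 → Θ.coeff n = 0)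
    (G : Set (H × AddMonoidAlgebra C ℤ))
    (hG : ∀ p ∈ G, toSeries k C p.2 * Θ = Θ * toSeries k C (j p.1))
    (I : Subalgebra k H) (hI : I = Algebra.adjoin k (Prod.fst '' G)) :
    ∃ f : I →ₐ[k] C, ∀ p ∈ G, ∀ h : p.1 ∈ I, f ⟨p.1, h⟩ = evalOne k C p.2 := by
  set A := Algebra.adjoin k G with hA
  have hAG : ∀ p ∈ A, toSeries k C p.2 * Θ = Θ * toSeries k C (j p.1) := by
    intro p hp
    induction hp using Algebra.adjoin_induction with
    | mem x hx => exact hG x hx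
    | algebraMap r =>
      have := Algebra.commutes r Θ
      have e1 : (algebraMap k (H × AddMonoidAlgebra C ℤ) r).1 = algebraMap k H r := rfl
      have e2 : (algebraMap k (H × AddMonoidAlgebra C ℤ) r).2 = algebraMap k _ r := rfl
      rw [e1, e2, AlgHom.commutes, AlgHom.commutes, AlgHom.commutes, this]
    | add x y _ _ hx hy => simp [add_mul, mul_add, hx, hy]
    | mul x y _ _ hx hy =>
      simp only [Prod.snd_mul, Prod.fst_mul, map_mul]
      rw [mul_assoc, hy, ← mul_assoc, hx, mul_assoc]
  have hinj : Function.Injective ((AlgHom.fst k H (AddMonoidAlgebra C ℤ)).comp A.val) := by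
    rw [injective_iff_map_eq_zero]
    rintro ⟨⟨u, v⟩, hp⟩ h0
    have hu : u = 0 := h0
    subst hu
    have h := hAG _ hp
    simp only [map_zero, mul_zero] at h
    have hv : toSeries k C v = 0 := by
      by_contra hne
      have ho : Θ.order = 0 := by
        have : Nontrivial C := by
          by_contra hC
          rw [not_nontrivial_iff_subsingleton] at hC
          exact hne (HahnSeries.ext (funext fun n => Subsingleton.elim _ _))
        have h0 : Θ.coeff 0 ≠ 0 := by rw [h3]; exact one_ne_zero
        have h1 : Θ ≠ 0 := by rintro rfl; simp at h0
        apply le_antisymm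
        · exact HahnSeries.order_le_of_coeff_ne_zero h0
        · by_contra hlt
          push Not at hlt
          exact (HahnSeries.coeff_order_eq_zero.not.2 h1) (hneg _ hlt)
      have h2 := HahnSeries.coeff_mul_order_add_order (toSeries k C v) Θ
      rw [h, HahnSeries.leadingCoeff_eq (x := Θ), ho] at h2
      rw [h3, mul_one] at h2
      exact hne (HahnSeries.leadingCoeff_eq_zero.1 (by simpa using h2.symm))
    have hv' : v = 0 := by
      ext n
      rw [← toSeries_coeff (k := k) v n, hv]; simp
    subst hv'
    rfl
  let e := AlgEquiv.ofInjective _ hinj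
  have hr : I = ((AlgHom.fst k H (AddMonoidAlgebra C ℤ)).comp A.val).range := by
    rw [hI, AlgHom.range_comp, Subalgebra.range_val, hA, AlgHom.map_adjoin]
    rfl
  subst hr
  refine ⟨((evalOne k C).comp ((AlgHom.snd k H _).comp A.val)).comp e.symm.toAlgHom, ?_⟩
  intro p hp h
  have : e ⟨p, Algebra.subset_adjoin hp⟩ = ⟨p.1, h⟩ := Subtype.ext rfl
  rw [← this]
  simp

end

section scalars
/-- Coefficients of a `q`-exponential (auxiliary, for the construction of `τ_R`). -/
def qexpCoeff (r : k) : ℕ → k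
  | 0 => 1
  | n + 1 => -(r - r⁻¹) * r ^ n * qexpCoeff r n / (1 - r ^ (n + 1))

variable {r : k}

theorem qexp_one (hr0 : r ≠ 0) (hr : ∀ n : ℕ, 0 < n → r ^ n ≠ 1) (n : ℕ) :
    qexpCoeff r (n + 1) * (1 - r ^ (n + 1)) = -(r - r⁻¹) * r ^ n * qexpCoeff r n := by
  have : 1 - r ^ (n + 1) ≠ 0 := sub_ne_zero.2 (hr _ n.succ_pos).symm
  rw [qexpCoeff]; field_simp

theorem qexp_B (hr0 : r ≠ 0) (hr : ∀ n : ℕ, 0 < n → r ^ n ≠ 1) (n : ℕ) :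
    qexpCoeff r (n + 1) * ((1 - r ^ (n + 1)) / (1 - r)) + qexpCoeff r n * (-(1 + r) / r * r ^ n)
      = 0 := by
  have h1 : 1 - r ≠ 0 := sub_ne_zero.2 (by simpa using (hr 1 one_pos).symm)
  have := qexp_one hr0 hr n
  rw [← mul_div_assoc, this]
  field_simp
  ring

theorem qexp_A (hr0 : r ≠ 0) (hr : ∀ n : ℕ, 0 < n → r ^ n ≠ 1) (n : ℕ) :
    qexpCoeff r (n + 2) * ((1 - (r ^ 2) ^ (n + 2)) / (1 - r ^ 2))
      + qexpCoeff r (n + 1) * (-(1 + r) / r * (r ^ 2) ^ (n + 1))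
      + qexpCoeff r n * ((r - r⁻¹) * (r ^ 2) ^ n) = 0 := by
  have h1 : 1 - r ≠ 0 := sub_ne_zero.2 (by simpa using (hr 1 one_pos).symm)
  have h2 : 1 - r ^ 2 ≠ 0 := sub_ne_zero.2 (hr 2 two_pos).symm
  have e1 := qexp_one hr0 hr n
  have e2 := qexp_one hr0 hr (n + 1)
  have e3 : qexpCoeff r (n + 2) * ((1 - (r ^ 2) ^ (n + 2)) / (1 - r ^ 2)) =
      (qexpCoeff r (n + 1 + 1) * (1 - r ^ (n + 1 + 1))) * (1 + r ^ (n + 2)) / (1 - r ^ 2) := by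
    rw [← pow_mul, mul_comm 2 (n + 2), pow_mul]; ring
  have e4 : qexpCoeff r n * ((r - r⁻¹) * (r ^ 2) ^ n) =
      - (-(r - r⁻¹) * r ^ n * qexpCoeff r n) * r ^ n := by
    rw [← pow_mul, mul_comm 2 n, pow_mul]; ring
  rw [e3, e4, e2, ← e1, ← pow_mul, mul_comm 2 (n + 1), pow_mul]
  field_simp
  ring
end scalars

section abstractTheta
variable {C : Type*} [Ring C] [Algebra k C]

/-- A `q`-exponential, as a Laurent series. -/
def qexp (r : k) (ξ : C) : HahnSeries ℤ C :=
  HahnSeries.ofSuppBddBelow (fun m : ℤ => if 0 ≤ m then qexpCoeff r m.toNat • ξ ^ m.toNat else 0)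
    ⟨0, by
      intro m hm
      by_contra h
      simp [if_neg h] at hm⟩

theorem qexp_coeff_neg (r : k) (ξ : C) (m : ℤ) (hm : m < 0) : (qexp r ξ).coeff m = 0 := by
  exact if_neg (not_le.2 hm)

theorem qexp_coeff_nat (r : k) (ξ : C) (n : ℕ) :
    (qexp r ξ).coeff n = qexpCoeff r n • ξ ^ n := by
  have : (qexp r ξ).coeff n = if (0 : ℤ) ≤ n then qexpCoeff r (n : ℤ).toNat • ξ ^ (n : ℤ).toNat
      else 0 := rfl
  rw [this, if_pos (Int.natCast_nonneg n), Int.toNat_natCast]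

variable {r : k} {ξ : C}

theorem qexp_comm {a : C} (h : a * ξ = ξ * a) (n : ℤ) :
    HahnSeries.single n a * qexp r ξ = qexp r ξ * HahnSeries.single n a := by
  ext m
  rw [HahnSeries.coeff_single_mul, HahnSeries.coeff_mul_single]
  rcases lt_or_ge (m - n) 0 with h0 | h0
  · simp [qexp_coeff_neg _ _ _ h0]
  · obtain ⟨i, hi⟩ := Int.eq_ofNat_of_zero_le h0
    rw [hi, qexp_coeff_nat, mul_smul_comm, smul_mul_assoc]
    congr 1
    exact (show Commute a ξ from h).pow_right i

theorem pow_of_qcomm {a : C} {t : k} (h : a * ξ = t • (ξ * a)) (n : ℕ) :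
    a * ξ ^ n = t ^ n • (ξ ^ n * a) := by
  induction n with
  | zero => simp
  | succ n ih =>
    rw [pow_succ, ← mul_assoc, ih, smul_mul_assoc, mul_assoc, h, mul_smul_comm, smul_smul,
      ← mul_assoc, ← pow_succ, ← pow_succ]

theorem qexp_x (hr0 : r ≠ 0) (hr : ∀ n : ℕ, 0 < n → r ^ n ≠ 1)
    {b : C} (h : b * ξ = r • (ξ * b)) :
    (HahnSeries.single (0 : ℤ) b + HahnSeries.single 1 (-(r - r⁻¹) • (ξ * b))) * qexp r ξ =
      qexp r ξ * HahnSeries.single 0 b := by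
  ext m
  rw [add_mul, HahnSeries.coeff_add, HahnSeries.coeff_single_mul, HahnSeries.coeff_single_mul,
    HahnSeries.coeff_mul_single, sub_zero]
  rcases lt_or_ge m 0 with h0 | h0
  · simp [qexp_coeff_neg _ _ _ h0, qexp_coeff_neg _ _ (m - 1) (by lia)]
  · obtain ⟨i, rfl⟩ := Int.eq_ofNat_of_zero_le h0
    rcases i with _ | n
    · have := qexp_coeff_nat r ξ 0
      simp only [Nat.cast_zero] at this ⊢
      rw [this, qexp_coeff_neg _ _ (0 - 1) (by lia)]
      simp [qexpCoeff]
    · have e : ((n + 1 : ℕ) : ℤ) - 1 = n := by push_cast; ring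
      rw [e, qexp_coeff_nat, qexp_coeff_nat, mul_smul_comm, mul_smul_comm, smul_mul_assoc,
        smul_mul_assoc, mul_assoc ξ b, pow_of_qcomm h, pow_of_qcomm h, mul_smul_comm, ← mul_assoc,
        ← pow_succ']
      have := qexp_one hr0 hr n
      match_scalars
      linear_combination -this

theorem qexp_z (hr0 : r ≠ 0) (hr : ∀ n : ℕ, 0 < n → r ^ n ≠ 1)
    {d D₁ D₂ : C} (h : d * ξ = ξ * d + (D₁ + D₂))
    (h1 : D₁ * ξ = (r ^ 2) • (ξ * D₁)) (h2 : D₂ * ξ = r • (ξ * D₂)) :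
    (HahnSeries.single (-1 : ℤ) d + HahnSeries.single 0 ((-(1 + r) / r) • (D₁ + D₂))
      + HahnSeries.single 1 ((r - r⁻¹) • (ξ * D₁))) * qexp r ξ =
      qexp r ξ * HahnSeries.single (-1) d := by
  have hr1 : 1 - r ≠ 0 := sub_ne_zero.2 (by simpa using (hr 1 one_pos).symm)
  have hr2 : 1 - r ^ 2 ≠ 0 := sub_ne_zero.2 (hr 2 two_pos).symm
  have key (n : ℕ) : d * ξ ^ (n + 1) = ξ ^ (n + 1) * d +
      (((1 - (r ^ 2) ^ (n + 1)) / (1 - r ^ 2)) • (ξ ^ n * D₁) +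
       ((1 - r ^ (n + 1)) / (1 - r)) • (ξ ^ n * D₂)) := by
    induction n with
    | zero => simp [h, div_self hr1, div_self hr2]
    | succ n ih =>
      rw [pow_succ ξ (n + 1), ← mul_assoc, ih]
      simp only [add_mul, smul_mul_assoc, mul_assoc, h, h1, h2, mul_add, mul_smul_comm]
      simp only [← mul_assoc, ← pow_succ]
      match_scalars
      · ring
      · field_simp; ring
      · field_simp; ring
  ext m
  rw [add_mul, add_mul, HahnSeries.coeff_add, HahnSeries.coeff_add, HahnSeries.coeff_single_mul,
    HahnSeries.coeff_single_mul, HahnSeries.coeff_single_mul,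
    HahnSeries.coeff_mul_single, sub_zero, sub_neg_eq_add]
  rcases lt_or_ge (m + 1) 0 with h0 | h0
  · simp [qexp_coeff_neg _ _ _ h0, qexp_coeff_neg _ _ (m - 1) (by lia),
      qexp_coeff_neg _ _ m (by lia)]
  · obtain ⟨i, hi⟩ := Int.eq_ofNat_of_zero_le h0
    obtain rfl : m = (i : ℤ) - 1 := by lia
    rw [sub_add_cancel]
    rcases i with _ | _ | n
    · have := qexp_coeff_nat r ξ 0
      simp only [Nat.cast_zero] at this ⊢
      rw [this, qexp_coeff_neg _ _ (0 - 1) (by lia), qexp_coeff_neg _ _ (0 - 1 - 1) (by lia)]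
      simp [qexpCoeff]
    · have e : ((0 + 1 : ℕ) : ℤ) - 1 = (0 : ℕ) := by simp
      rw [e, qexp_coeff_neg _ _ (((0 : ℕ) : ℤ) - 1) (by simp), qexp_coeff_nat, qexp_coeff_nat,
        mul_smul_comm, key 0]
      have := qexp_B hr0 hr 0
      simp only [zero_add, pow_one, div_self hr1, div_self hr2, pow_zero, one_mul, mul_zero,
        mul_one, add_zero, smul_mul_assoc, mul_smul_comm] at this ⊢
      match_scalars
      · ring
      · linear_combination this
      · linear_combination this
    · have e : ((n + 1 + 1 : ℕ) : ℤ) - 1 = (n + 1 : ℕ) := by push_cast; ring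
      have e' : ((n + 1 : ℕ) : ℤ) - 1 = (n : ℕ) := by push_cast; ring
      rw [e, e', qexp_coeff_nat, qexp_coeff_nat, qexp_coeff_nat]
      simp only [mul_smul_comm, smul_mul_assoc, key, add_mul, mul_assoc, pow_of_qcomm h1,
        pow_of_qcomm h2]
      simp only [← mul_assoc, ← pow_succ']
      have hB := qexp_B hr0 hr (n + 1)
      have hA := qexp_A hr0 hr n
      match_scalars
      · ring
      · linear_combination hA
      · linear_combination hB
end abstractTheta

theorem exists_grading (h : IsGeneric s) :
    ∃ j : Osp k s →ₐ[k] AddMonoidAlgebra (Osp k s ⊗[k] Osp k s) ℤ,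
      j (Ap s) = .single (-1) ((Kinv s ^ 2 * P s) ⊗ₜ Ap s) ∧
      j (Am s) = .single 1 ((K s ^ 2 * P s) ⊗ₜ Am s) ∧
      j (K s) = .single 0 (1 ⊗ₜ K s) ∧
      j (Kinv s) = .single 0 (1 ⊗ₜ Kinv s) ∧ j (P s) = .single 0 (1 ⊗ₜ P s) := by
  refine ⟨_, lift_gens _ _ _ _ _ (Relations.of_and ?_)⟩
  have hs := h.1; have := h.h1; have := h.h2
  simp only [sq, AddMonoidAlgebra.single_mul_single, AddMonoidAlgebra.one_def,
    ← AddMonoidAlgebra.single_add, ← AddMonoidAlgebra.single_sub, add_zero, zero_add,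
    AddMonoidAlgebra.smul_single, add_neg_cancel, neg_add_cancel]
  have e0 : (0 : AddMonoidAlgebra (Osp k s ⊗[k] Osp k s) ℤ) = .single 0 0 := by simp
  have e1 : (0 : AddMonoidAlgebra (Osp k s ⊗[k] Osp k s) ℤ) = .single 1 0 := by simp
  have e2 : (0 : AddMonoidAlgebra (Osp k s ⊗[k] Osp k s) ℤ) = .single (-1) 0 := by simp
  refine ⟨congrArg _ ?_, congrArg _ ?_, congrArg _ ?_, congrArg _ ?_, congrArg _ ?_,
    (congrArg _ ?_).trans e2.symm, (congrArg _ ?_).trans e1.symm,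
    (congrArg _ ?_).trans e0.symm, (congrArg _ ?_).trans e0.symm, congrArg _ ?_⟩
  all_goals
    try simp only [casimir, h.e2]
    simp only [h.e1, tmul_mul_tmul, sq, mul_add, add_mul,
      mul_sub, sub_mul, smul_mul_assoc, mul_smul_comm, mul_assoc, smul_sub, smul_add, neg_mul,
      mul_neg, smul_neg, smul_smul, neg_neg, sub_neg_eq_add, mul_one, one_mul, one_def,
      KA, KM, kA hs, kM hs, PA, PM, PK, Pk, PP, MA, K_mul_Kinv, Kinv_mul_K,
      KA', KM', kA' _ hs, kM' _ hs, PA', PM', PK', Pk', PP', MA', Kk', kK',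
      TensorProduct.tmul_add, TensorProduct.add_tmul, TensorProduct.tmul_sub,
      TensorProduct.sub_tmul, TensorProduct.tmul_neg, TensorProduct.neg_tmul,
      ← TensorProduct.smul_tmul', TensorProduct.tmul_smul]
    all_goals match_scalars
    all_goals try field_simp
    all_goals try ring

theorem casimir_comm' (h : IsGeneric s) (a : Osp k s) : casimir s * a = a * casimir s := by
  obtain ⟨b, rfl⟩ := RingQuot.mkAlgHom_surjective k (OspRel k s) a
  change casimir s * mk s b = mk s b * casimir s
  induction b using FreeAlgebra.induction with
  | grade0 r => rw [AlgHom.commutes, Algebra.commutes]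
  | grade1 g => exact casimir_comm h g
  | mul a b ha hb => rw [map_mul, ← mul_assoc, ha, mul_assoc, hb, mul_assoc]
  | add a b ha hb => rw [map_add, mul_add, ha, hb, add_mul]

/-- There is exactly one algebra morphism with the prescribed values. -/
theorem existsUnique_tauR (h : IsGeneric s) :
    ∃! τ : IR s →ₐ[k] Osp k s ⊗[k] IR s, IsTauR τ := by
  have hs := h.1
  have hss : s ^ 2 ≠ 0 := pow_ne_zero 2 hs
  obtain ⟨r, hr⟩ : ∃ r : k, r = -(s ^ 2)⁻¹ := ⟨_, rfl⟩
  have hr0 : r ≠ 0 := by rw [hr]; exact neg_ne_zero.2 (inv_ne_zero hss)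
  have hrn : ∀ n : ℕ, 0 < n → r ^ n ≠ 1 := by
    intro n hn h1
    apply h.2 (2 * n) (by lia)
    have h2 : (r ^ n) ^ 2 = 1 := by rw [h1, one_pow]
    have h3 : (r ^ n) ^ 2 = ((s ^ 2) ^ (2 * n))⁻¹ := by
      rw [hr, ← pow_mul, mul_comm n 2, (even_two_mul n).neg_pow, inv_pow]
    rw [h3] at h2
    exact inv_eq_one.1 h2
  have hQ : r - r⁻¹ = s ^ 2 - (s ^ 2)⁻¹ := by rw [hr, inv_neg, inv_inv]; ring
  obtain ⟨L1, L2, L3, L4, L5, L6, L7⟩ := tens_rules h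
  obtain ⟨j, jA, jM, jK, jk, jP⟩ := exists_grading h
  have jz : j (Ap s * K s) = .single (-1) ((Kinv s ^ 2 * P s) ⊗ₜ (Ap s * K s)) := by
    rw [map_mul, jA, jK, AddMonoidAlgebra.single_mul_single, tmul_mul_tmul, mul_one, add_zero]
  have jy : j (Am s * K s) = .single 1 ((K s ^ 2 * P s) ⊗ₜ (Am s * K s)) := by
    rw [map_mul, jM, jK, AddMonoidAlgebra.single_mul_single, tmul_mul_tmul, mul_one, add_zero]
  have jx : j (K s ^ 2 * P s) = .single 0 (1 ⊗ₜ (K s ^ 2 * P s)) := by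
    rw [map_mul, map_pow, jP, jK, sq, sq, AddMonoidAlgebra.single_mul_single,
      AddMonoidAlgebra.single_mul_single, tmul_mul_tmul, tmul_mul_tmul, mul_one, mul_one,
      add_zero, add_zero]
  have jc : j (casimir s) = .single 0 (1 ⊗ₜ casimir s) := by
    rw [casimir, map_mul, map_add, map_neg, map_smul, map_sub, map_smul, map_smul, map_mul,
      map_pow, map_pow, jP, jK, jk, jA, jM]
    simp only [sq, AddMonoidAlgebra.single_mul_single, ← AddMonoidAlgebra.single_add,
      ← AddMonoidAlgebra.single_sub, add_zero, ← AddMonoidAlgebra.single_neg,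
      AddMonoidAlgebra.smul_single, neg_add_cancel]
    congr 1
    have := h.h1; have := h.h2
    try simp only [casimir, h.e2]
    simp only [h.e1, tmul_mul_tmul, sq, mul_add, add_mul,
      mul_sub, sub_mul, smul_mul_assoc, mul_smul_comm, mul_assoc, smul_sub, smul_add, neg_mul,
      mul_neg, smul_neg, smul_smul, neg_neg, sub_neg_eq_add, mul_one, one_mul, one_def,
      KA, KM, kA hs, kM hs, PA, PM, PK, Pk, PP, MA, K_mul_Kinv, Kinv_mul_K,
      KA', KM', kA' _ hs, kM' _ hs, PA', PM', PK', Pk', PP', MA', Kk', kK',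
      TensorProduct.tmul_add, TensorProduct.add_tmul, TensorProduct.tmul_sub,
      TensorProduct.sub_tmul, TensorProduct.tmul_neg, TensorProduct.neg_tmul,
      ← TensorProduct.smul_tmul', TensorProduct.tmul_smul]
  have Gy := qexp_comm (r := r) L1 1
  have Gc := qexp_comm (r := r) (a := (1 : Osp k s) ⊗ₜ[k] casimir s)
    (ξ := (Ap s * K s) ⊗ₜ[k] (Am s * Kinv s * P s))
    (by rw [tmul_mul_tmul, tmul_mul_tmul, one_mul, mul_one, casimir_comm' h]) 0
  rw [← hr] at L2 L6
  have Gx := qexp_x hr0 hrn L2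
  have Gz := qexp_z hr0 hrn L4 (by rw [L5, hr, neg_sq]) L6
  have l7 : (r - r⁻¹) • ((Ap s * K s) ⊗ₜ[k] (Am s * Kinv s * P s) *
        (s ^ 2)⁻¹ • (Ap s * Kinv s * P s) ⊗ₜ[k] (K s ^ 2 * P s)) =
      (s⁻¹ * (s ^ 2 - (s ^ 2)⁻¹)) • ((Ap s ^ 2 * P s) ⊗ₜ[k] (Am s * K s)) := by
    rw [L7, smul_smul, hQ]
    congr 1
    field_simp
  have l3 : -(r - r⁻¹) • ((Ap s * K s) ⊗ₜ[k] (Am s * Kinv s * P s) *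
        (1 : Osp k s) ⊗ₜ[k] (K s ^ 2 * P s)) =
      -(s ^ 2 - (s ^ 2)⁻¹) • ((Ap s * K s) ⊗ₜ[k] (Am s * K s)) := by
    rw [hQ, L3]
  have lD : (-(1 + r) / r) • ((s ^ 2)⁻¹ • (Ap s * Kinv s * P s) ⊗ₜ[k] (K s ^ 2 * P s) +
        ((s ^ 2)⁻¹ * (s + s⁻¹)) • (Ap s * Kinv s * P s) ⊗ₜ[k] casimir s) =
      (s⁻¹ * (s - s⁻¹)) • ((Ap s * Kinv s * P s) ⊗ₜ[k] (K s ^ 2 * P s)) +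
      (s⁻¹ * (s ^ 2 - (s ^ 2)⁻¹)) • ((Ap s * Kinv s * P s) ⊗ₜ[k] casimir s) := by
    rw [smul_add, smul_smul, smul_smul, hr]
    congr 2
    · field_simp; ring
    · field_simp; ring
  rw [l7, lD] at Gz
  rw [l3] at Gx
  obtain ⟨f, hf⟩ := exists_hom_of_intertwiner j _ (by simpa [qexpCoeff] using qexp_coeff_nat r ((Ap s * K s) ⊗ₜ[k] (Am s * Kinv s * P s)) 0)
    (qexp_coeff_neg r ((Ap s * K s) ⊗ₜ[k] (Am s * Kinv s * P s)))
    {(Ap s * K s, .single (-1) ((Kinv s ^ 2 * P s) ⊗ₜ (Ap s * K s)) +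
        .single 0 ((s⁻¹ * (s - s⁻¹)) • ((Ap s * Kinv s * P s) ⊗ₜ[k] (K s ^ 2 * P s)) +
          (s⁻¹ * (s ^ 2 - (s ^ 2)⁻¹)) • ((Ap s * Kinv s * P s) ⊗ₜ[k] casimir s)) +
        .single 1 ((s⁻¹ * (s ^ 2 - (s ^ 2)⁻¹)) • ((Ap s ^ 2 * P s) ⊗ₜ[k] (Am s * K s)))),
      (Am s * K s, .single 1 ((K s ^ 2 * P s) ⊗ₜ (Am s * K s))),
      (K s ^ 2 * P s, .single 0 (1 ⊗ₜ (K s ^ 2 * P s)) +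
        .single 1 (-(s ^ 2 - (s ^ 2)⁻¹) • ((Ap s * K s) ⊗ₜ[k] (Am s * K s)))),
      (casimir s, .single 0 (1 ⊗ₜ casimir s))}
    (by
      intro p hp
      simp only [Set.mem_insert_iff, Set.mem_singleton_iff] at hp
      rcases hp with rfl | rfl | rfl | rfl
      · simp only [map_add, toSeries_single, jz]; exact Gz
      · simp only [toSeries_single, jy]; exact Gy
      · simp only [map_add, toSeries_single, jx]; exact Gx
      · simp only [toSeries_single, jc]; exact Gc)
    (IR s) (by simp only [Set.image_insert_eq, Set.image_singleton]; rfl)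
  have f1 := hf _ (Or.inl rfl) (IR.ApK s).2
  have f2 := hf _ (Or.inr (Or.inl rfl)) (IR.AmK s).2
  have f3 := hf _ (Or.inr (Or.inr (Or.inl rfl))) (IR.KsqP s).2
  have f4 := hf _ (Or.inr (Or.inr (Or.inr rfl))) (IR.cas s).2
  simp only [map_add, evalOne_single] at f1 f2 f3 f4
  have t (a : Osp k s) (b : IR s) : inclIR s (a ⊗ₜ b) = a ⊗ₜ (b : Osp k s) := rfl
  have g1 : f (IR.ApK s) = inclIR s ((Kinv s ^ 2 * P s) ⊗ₜ IR.ApK s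
    + (s⁻¹ * (s ^ 2 - (s ^ 2)⁻¹)) • ((Ap s ^ 2 * P s) ⊗ₜ IR.AmK s)
    + (s⁻¹ * (s - s⁻¹)) • ((Ap s * Kinv s * P s) ⊗ₜ IR.KsqP s)
    + (s⁻¹ * (s ^ 2 - (s ^ 2)⁻¹)) • ((Ap s * Kinv s * P s) ⊗ₜ IR.cas s)) := by
    refine Eq.trans f1 ?_
    simp only [map_add, map_smul, t, IR.ApK, IR.AmK, IR.KsqP, IR.cas]
    abel
  have g2 : f (IR.AmK s) = inclIR s ((K s ^ 2 * P s) ⊗ₜ IR.AmK s) := f2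
  have g3 : f (IR.KsqP s) = inclIR s
      (1 ⊗ₜ IR.KsqP s - (s ^ 2 - (s ^ 2)⁻¹) • ((Ap s * K s) ⊗ₜ IR.AmK s)) := by
    refine Eq.trans f3 ?_
    simp only [map_sub, map_smul, t, IR.AmK, IR.KsqP]
    rw [neg_smul]
    exact (sub_eq_add_neg _ _).symm
  have g4 : f (IR.cas s) = inclIR s (1 ⊗ₜ IR.cas s) := f4
  obtain ⟨g, hg⟩ := exists_lift_inclIR f ⟨_, g1.symm⟩ ⟨_, g2.symm⟩ ⟨_, g3.symm⟩ ⟨_, g4.symm⟩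
  have hg' (u : IR s) : inclIR s (g u) = f u := congrArg (· u) (congrArg DFunLike.coe hg)
  refine ⟨g, ⟨?_, ?_, ?_, ?_⟩, ?_⟩
  · exact inclIR_injective ((hg' _).trans g2)
  · exact inclIR_injective ((hg' _).trans g1)
  · exact inclIR_injective ((hg' _).trans g3)
  · exact inclIR_injective ((hg' _).trans g4)
  · intro τ hτ
    apply IR.hom_ext
    · exact hτ.ApK.trans (inclIR_injective ((hg' _).trans g1)).symm
    · exact hτ.AmK.trans (inclIR_injective ((hg' _).trans g2)).symm
    · exact hτ.KsqP.trans (inclIR_injective ((hg' _).trans g3)).symm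
    · exact hτ.cas.trans (inclIR_injective ((hg' _).trans g4)).symm

/-- `I_R` is a left coideal: the coproduct restricts to an algebra morphism from `I_R` to
`osp_q(1|2) ⊗ I_R`. -/
theorem existsUnique_coproductR (h : IsGeneric s) :
    ∃! f : IR s →ₐ[k] Osp k s ⊗[k] IR s, (inclIR s).comp f = (coproduct h).comp (IR s).val := by
  obtain ⟨dA, dM, dK, dk, dP⟩ := coproduct_gens h
  obtain ⟨c1, c2, c3, c4⟩ := coproduct_formulas h
  have t (a : Osp k s) (b : IR s) : inclIR s (a ⊗ₜ b) = a ⊗ₜ (b : Osp k s) := rfl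
  have e : coproduct h (casimir s) =
      casimir s ⊗ₜ[k] (K s ^ 2 * P s) + (Kinv s ^ 2 * P s) ⊗ₜ[k] casimir s
      + ((s ^ 2 - (s ^ 2)⁻¹)⁻¹ * (s - s⁻¹)) • ((Kinv s ^ 2 * P s) ⊗ₜ[k] (K s ^ 2 * P s))
      + s⁻¹ • ((Ap s * Kinv s * P s) ⊗ₜ[k] (Am s * K s))
      - s • ((Am s * Kinv s * P s) ⊗ₜ[k] (Ap s * K s)) := by
    rw [← c4]
    rw [casimir, map_mul, map_add, map_neg, map_smul, map_sub, map_smul, map_smul, map_mul,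
      map_pow, map_pow, dA, dM, dK, dk, dP]
  obtain ⟨f, hf⟩ := exists_lift_inclIR ((coproduct h).comp (IR s).val)
    ⟨(Ap s * K s) ⊗ₜ IR.KsqP s + 1 ⊗ₜ IR.ApK s, by
      change inclIR s _ = coproduct h (Ap s * K s)
      rw [map_mul, dA, dK, c1]; simp only [map_add, t]; rfl⟩
    ⟨(Am s * K s) ⊗ₜ IR.KsqP s + 1 ⊗ₜ IR.AmK s, by
      change inclIR s _ = coproduct h (Am s * K s)
      rw [map_mul, dM, dK, c2]; simp only [map_add, t]; rfl⟩
    ⟨(K s ^ 2 * P s) ⊗ₜ IR.KsqP s, by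
      change inclIR s _ = coproduct h (K s ^ 2 * P s)
      rw [map_mul, map_pow, dK, dP, c3]; rfl⟩
    ⟨casimir s ⊗ₜ IR.KsqP s + (Kinv s ^ 2 * P s) ⊗ₜ IR.cas s
      + ((s ^ 2 - (s ^ 2)⁻¹)⁻¹ * (s - s⁻¹)) • ((Kinv s ^ 2 * P s) ⊗ₜ IR.KsqP s)
      + s⁻¹ • ((Ap s * Kinv s * P s) ⊗ₜ IR.AmK s)
      - s • ((Am s * Kinv s * P s) ⊗ₜ IR.ApK s), by
      change inclIR s _ = coproduct h (casimir s)
      rw [e]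
      simp only [map_add, map_sub, map_smul, t]; rfl⟩
  refine ⟨f, hf, fun g hg => AlgHom.ext fun u => inclIR_injective ?_⟩
  exact congrArg (fun φ : IR s →ₐ[k] _ => φ u) (hg.trans hf.symm)

/-- The coproduct, restricted to a morphism `Δ : I_R → osp_q(1|2) ⊗ I_R`. -/
def coproductR (h : IsGeneric s) : IR s →ₐ[k] Osp k s ⊗[k] IR s := (existsUnique_coproductR h).choose

theorem coproductR_spec (h : IsGeneric s) :
    (inclIR s).comp (coproductR h) = (coproduct h).comp (IR s).val :=
  (existsUnique_coproductR h).choose_spec.1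

/-- The coaction `τ_R : I_R → osp_q(1|2) ⊗ I_R`, i.e. the algebra morphism with the values
`IsTauR` on the generators of `I_R`. -/
def tauR (h : IsGeneric s) : IR s →ₐ[k] Osp k s ⊗[k] IR s := (existsUnique_tauR h).choose

theorem tauR_spec (h : IsGeneric s) : IsTauR (tauR h) := (existsUnique_tauR h).choose_spec.1

/-- The tensor power `osp_q(1|2)^{⊗ n}`, bracketed to the right:
`osp ⊗ (osp ⊗ (⋯ ⊗ (osp ⊗ k)))`. -/
def ospPow {k : Type u} [Field k] (s : k) : ℕ → AlgCat.{u} k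
  | 0 => AlgCat.of k k
  | n + 1 => AlgCat.of k (Osp k s ⊗[k] ospPow s n)

/-- The right extension process for the set `A`, for the tensor positions `j, j + 1, …, j + m`.
It starts with an element `u` of `I_R` in position `j`. As long as some element of `A` lies to the
right of the current position, a morphism is applied to the last tensor factor, which splits it in
two and so moves on to the next position: this morphism is `Δ` if the current position is in `A`,
and `τ_R` if it is not. So, for `A = {a₁ < ⋯ < a_r}` and `j = a₁`, the element `a_i` (for `i < r`)
contributes one application of `Δ`, followed by `a_{i+1} - a_i - 1` applications of `τ_R`. Once the
last element of `A` is reached, the remaining positions are filled with `1`.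
The recursion uses
`(1^{⊗ ℓ} ⊗ f_ℓ) ⋯ (1 ⊗ f_1) f_0 = (1 ⊗ ((1^{⊗ (ℓ-1)} ⊗ f_ℓ) ⋯ (1 ⊗ f_2) f_1)) f_0`. -/
def extendRight {k : Type u} [Field k] {s : k} (h : IsGeneric s) (A : Finset ℕ) :
    (m : ℕ) → (j : ℕ) → IR s →ₐ[k] Osp k s ⊗[k] ospPow s m
  | 0, _ => includeLeft.comp (IR s).val
  | m + 1, j =>
    if ∃ a ∈ A, j < a then
      (Algebra.TensorProduct.map (AlgHom.id k (Osp k s)) (extendRight h A m (j + 1))).comp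
        (if j ∈ A then coproductR h else tauR h)
    else includeLeft.comp (IR s).val

/-- Positions `j, …, j + m - 1` of `1 ⊗ ⋯ ⊗ 1 ⊗ (extension of Γ^q) ⊗ 1 ⊗ ⋯ ⊗ 1`, where the
extension of `Γ^q` starts at the first position that belongs to `A`. -/
def gammaFrom {k : Type u} [Field k] {s : k} (h : IsGeneric s) (A : Finset ℕ) :
    (m : ℕ) → (j : ℕ) → ospPow s m
  | 0, _ => (1 : k)
  | m + 1, j =>
    if j ∈ A then extendRight h A m j (IR.cas s)
    else (1 : Osp k s) ⊗ₜ[k] gammaFrom h A m (j + 1)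

/-- The generator `Γ_A^q ∈ osp_q(1|2)^{⊗ n}` of the higher rank `q`-Bannai-Ito algebra, for
`A ⊆ {1, …, n}`. For the empty set it is the scalar `-1 / (q^{1/2} + q^{-1/2})`. -/
def gamma {k : Type u} [Field k] {s : k} (h : IsGeneric s) (n : ℕ) (A : Finset ℕ) : ospPow s n :=
  if A = ∅ then algebraMap k (ospPow s n) (-(s + s⁻¹)⁻¹) else gammaFrom h A n 1

/-- The `q`-anticommutator `{X, Y}_q = q^{1/2} X Y + q^{-1/2} Y X`, where `s = q^{1/2}`. -/
def qAnticomm {k B : Type*} [Field k] [Ring B] [Algebra k B] (s : k) (X Y : B) : B :=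
  s • (X * Y) + s⁻¹ • (Y * X)

/-- `A ≺ B`: `max A < min B`, or `A` or `B` is empty. -/
def Prec (A B : Finset ℕ) : Prop := ∀ a ∈ A, ∀ b ∈ B, a < b

end

end QBI

/-! The relations are skein relations between quantum traces of matrices that satisfy the reflection
equation. The generators of `I_R` fit into a 2 × 2 matrix `IRMat` which satisfies the reflection
equation for the Hecke-type matrix `braid = 1 - cupcap` and has quantum determinant one
(`isReflection_IRMat`). Its quantum trace is `r • Γ^q` with `r = s (q - q⁻¹)`.

Both extension steps act on this matrix by matrix products. The coaction `τ_R` conjugates the matrix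
built so far by a triangular `L`-operator with entries in the leftmost tensor factor
(`extendTau_IRMat`). The coproduct does the same and then multiplies from the left by the copy of
`IRMat` in that factor (`extendCoproduct_IRMat`). The counit sends `IRMat` to the identity. Hence
every `A` has a matrix `M_A` (`extendMat`) with `qtr M_A = r • Γ_A`, `M_∅ = 1`, and `M_{A ∪ B} = M_A
M_B` when `A ≺ B` (`extendMat_union`). For `A ≺ B` the entries of `M_A` and `M_B` obey the exchange
relation `Exchange` (`exchange_extendMat`), because the `L`-operator satisfies an RTT relation and
intertwines `IRMat` with its braided conjugate.

With `X_i = M_{A_i}`, the theorem becomes an identity between quantum traces of products of the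
`X_i` (`skein_one`, `skein_two`, `skein_three`). Conjugating `Y` by `braid` or by its inverse are
the two ways of crossing two strands. Weighted by `s` and `s⁻¹`, the two conjugates add up to a
multiple of `Y`, one term with `cupcap` and `Y`, and one with `cupcap` and `qtr Y` (`skein_left`,
`skein_right`). These yield the product over the union, the symmetric difference, and the product of
the two set differences. The determinant condition deletes a doubled strand next to `cupcap`. In the
first two cases `A ∩ B` is a single block and one strand is cut open; in the third `A ∩ B = A₁ ∪
A₄`, and the whole double trace is used. -/

namespace QBI
set_option linter.unusedSimpArgs false
open scoped TensorProduct
open Matrix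

/-! ### The Hecke braiding, quantum traces and the skein identities for scalar matrices. -/

section matrices
variable {k B : Type*} [Field k] [Ring B] [Algebra k B]

/-- Two by two matrices over `B`. -/
abbrev M2 (B : Type*) := Matrix (Fin 2) (Fin 2) B

/-- Two by two block matrices, viewed as elements of `End(k²) ⊗ End(k²) ⊗ B`: the rows and columns
of the blocks belong to the inner factor. -/
abbrev M4 (B : Type*) := M2 (M2 B)

/-- A matrix acting on the inner factor. -/
def inner (B : Type*) [Ring B] : M2 B →+* M4 B := Matrix.scalar (Fin 2)

/-- A matrix acting on the outer factor. -/
def outer (B : Type*) [Ring B] : M2 B →+* M4 B := (Matrix.scalar (Fin 2)).mapMatrix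

/-- A scalar, as a two by two matrix. -/
abbrev sc (b : B) : M2 B := Matrix.scalar (Fin 2) b

/-- The quantum trace. -/
def qtr (s : k) (X : M2 B) : B := X 0 0 - s ^ 2 • X 1 1

/-- The partial quantum trace over the outer factor. -/
def ptr (s : k) (M : M4 B) : M2 B := M 0 0 - s ^ 2 • M 1 1

/-- A multiple of the projection on the `q`-antisymmetric tensors. -/
def cupcap (s : k) (B : Type*) [Ring B] [Algebra k B] : M4 B :=
  !![!![0, 0; 0, 1], !![0, 0; (s ^ 2)⁻¹ • 1, 0];
     !![0, -1; 0, 0], !![-((s ^ 2)⁻¹ • 1), 0; 0, 0]]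

/-- The braiding `R`-matrix. -/
def braid (s : k) (B : Type*) [Ring B] [Algebra k B] : M4 B := 1 - cupcap s B

/-- The inverse of the braiding. -/
def braidInv (s : k) (B : Type*) [Ring B] [Algebra k B] : M4 B := 1 + s ^ 2 • cupcap s B

variable {s : k}

theorem ptr_add (M N : M4 B) : ptr s (M + N) = ptr s M + ptr s N := by
  simp only [ptr, Matrix.add_apply, smul_add]; abel
theorem ptr_smul (r : k) (M : M4 B) : ptr s (r • M) = r • ptr s M := by
  simp only [ptr, Matrix.smul_apply, smul_sub, smul_comm r]
theorem qtr_add (M N : M2 B) : qtr s (M + N) = qtr s M + qtr s N := by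
  simp only [qtr, Matrix.add_apply, smul_add]; abel
theorem qtr_smul (r : k) (M : M2 B) : qtr s (r • M) = r • qtr s M := by
  simp only [qtr, Matrix.smul_apply, smul_sub, smul_comm r]

theorem ptr_mul_inner (M : M4 B) (Y : M2 B) : ptr s (M * inner B Y) = ptr s M * Y := by
  simp [ptr, inner, Matrix.mul_apply, Matrix.vecMul, dotProduct, Fin.sum_univ_two, sub_mul]
theorem ptr_inner_mul (M : M4 B) (Y : M2 B) : ptr s (inner B Y * M) = Y * ptr s M := by
  simp [ptr, inner, Matrix.mul_apply, Matrix.vecMul, dotProduct, Fin.sum_univ_two, mul_sub]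

theorem qtr_mul_sc (X : M2 B) (b : B) : qtr s (X * sc b) = qtr s X * b := by
  simp [qtr, sub_mul]
theorem qtr_sc_mul (X : M2 B) (b : B) : qtr s (sc b * X) = b * qtr s X := by
  simp [qtr, mul_sub]

theorem cupcap_comm_sc (b : B) : Commute (cupcap s B) (inner B (sc b)) := by
  ext i j i' j'
  fin_cases i <;> fin_cases j <;> fin_cases i' <;> fin_cases j' <;>
    simp [cupcap, inner]

theorem ptr_cupcap (hs : s ≠ 0) : ptr s (cupcap s B) = 1 := by
  ext i j
  fin_cases i <;> fin_cases j <;>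
    simp [ptr, cupcap, Matrix.sub_apply, Matrix.smul_apply, -smul_of, smul_smul, hs]

/-- `cupcap` has rank one: it is the column `e₀₁ - e₁₀` times the row `e₀₁ + q⁻¹ e₁₀`. Between two
copies only the row–column pairing of `X` survives, namely `X₁₁ - q⁻¹ X₀₀ = -q⁻¹ qtr X`. -/
theorem cupcap_inner_cupcap (hs : s ≠ 0) (X : M2 B) :
    cupcap s B * inner B X * cupcap s B = -((s ^ 2)⁻¹ • (inner B (sc (qtr s X)) * cupcap s B)) := by
  ext i j i' j'
  fin_cases i <;> fin_cases j <;> fin_cases i' <;> fin_cases j' <;>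
    simp [cupcap, inner, qtr, Matrix.mul_apply, Matrix.vecMul, dotProduct, Fin.sum_univ_two, smul_sub, smul_smul, hs,
      sub_mul, mul_sub, mul_assoc, Matrix.add_apply] <;> match_scalars <;> try field_simp

/-- The double quantum trace is the trace weighted by `diag(1, -q) ⊗ diag(1, -q)`. This weight is
the scalar `-q` on the span of `e₀₁` and `e₁₀`, where `cupcap` lives, so it commutes with `cupcap`,
whose coefficients are scalars. -/
theorem qtr_ptr_cupcap_mul (hs : s ≠ 0) (M : M4 B) :
    qtr s (ptr s (cupcap s B * M)) = qtr s (ptr s (M * cupcap s B)) := by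
  simp [cupcap, qtr, ptr, Matrix.mul_apply, Matrix.vecMul, dotProduct, Fin.sum_univ_two, Matrix.add_apply, Matrix.sub_apply,
    smul_sub, smul_add, smul_smul, hs]
  match_scalars <;> field_simp

theorem cupcap_sq (hs : s ≠ 0) : cupcap s B * cupcap s B = (1 - (s ^ 2)⁻¹) • cupcap s B := by
  have h := cupcap_inner_cupcap (s := s) hs (1 : M2 B)
  have e : sc (qtr s (1 : M2 B)) = (1 - s ^ 2) • (1 : M2 B) := by
    ext i j
    fin_cases i <;> fin_cases j <;> simp [qtr, sub_smul]
  have e' (r : k) : inner B (r • 1) = r • 1 := by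
    ext i j i' j'
    fin_cases i <;> fin_cases j <;> fin_cases i' <;> fin_cases j' <;> simp [inner]
  rw [e, e', map_one, mul_one, smul_mul_assoc, one_mul, smul_smul, ← neg_smul] at h
  rw [h]
  congr 1
  field_simp
  ring

theorem braid_mul_braidInv (hs : s ≠ 0) : braid s B * braidInv s B = 1 := by
  rw [braid, braidInv, sub_mul, mul_add, mul_add, mul_smul_comm, mul_smul_comm, cupcap_sq hs]
  simp only [one_mul, mul_one]
  match_scalars <;> field_simp; ring

theorem braidInv_mul_braid (hs : s ≠ 0) : braidInv s B * braid s B = 1 := by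
  rw [braid, braidInv, mul_sub, add_mul, add_mul, smul_mul_assoc, smul_mul_assoc, cupcap_sq hs]
  simp only [one_mul, mul_one]
  match_scalars <;> field_simp; ring

theorem commute_cupcap_of_commute_braid {M : M4 B} (h : Commute (braid s B) M) :
    Commute (cupcap s B) M := by
  have := (Commute.one_left M).sub_left h
  rwa [braid, sub_sub_cancel] at this

theorem braid_inner_braidInv (hs : s ≠ 0) (Y : M2 B) :
    braid s B * inner B Y * braidInv s B =
      inner B Y - cupcap s B * inner B Y + s ^ 2 • (inner B Y * cupcap s B)
        + inner B (sc (qtr s Y)) * cupcap s B := by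
  have h := cupcap_inner_cupcap (s := s) hs Y
  rw [braid, braidInv]
  simp only [sub_mul, mul_add, one_mul, mul_one, mul_smul_comm, h]
  match_scalars <;> field_simp

theorem braidInv_inner_braid (hs : s ≠ 0) (Y : M2 B) :
    braidInv s B * inner B Y * braid s B =
      inner B Y + s ^ 2 • (cupcap s B * inner B Y) - inner B Y * cupcap s B
        + inner B (sc (qtr s Y)) * cupcap s B := by
  have h := cupcap_inner_cupcap (s := s) hs Y
  rw [braid, braidInv]
  simp only [add_mul, mul_sub, one_mul, mul_one, smul_mul_assoc, h]
  match_scalars <;> field_simp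

/-- The weights `s` and `s⁻¹` of the `q`-anticommutator are exactly those that cancel the terms
`inner Y * cupcap`, with coefficients `-s` and `s⁻¹ s ^ 2`. In `skein_right` the roles are exchanged
and `cupcap * inner Y` disappears. -/
theorem skein_left (hs : s ≠ 0) (Y : M2 B) :
    s • (braidInv s B * inner B Y * braid s B) + s⁻¹ • (braid s B * inner B Y * braidInv s B) =
      (s + s⁻¹) • inner B Y + (s * (s ^ 2 - (s ^ 2)⁻¹)) • (cupcap s B * inner B Y)
        + (s + s⁻¹) • (inner B (sc (qtr s Y)) * cupcap s B) := by
  rw [braid_inner_braidInv hs, braidInv_inner_braid hs]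
  match_scalars <;> field_simp <;> ring

theorem skein_right (hs : s ≠ 0) (Y : M2 B) :
    s • (braid s B * inner B Y * braidInv s B) + s⁻¹ • (braidInv s B * inner B Y * braid s B) =
      (s + s⁻¹) • inner B Y + (s * (s ^ 2 - (s ^ 2)⁻¹)) • (inner B Y * cupcap s B)
        + (s + s⁻¹) • (inner B (sc (qtr s Y)) * cupcap s B) := by
  rw [braid_inner_braidInv hs, braidInv_inner_braid hs]
  match_scalars <;> field_simp <;> ring

theorem ptr_cupcap_mul_inner (hs : s ≠ 0) (Y : M2 B) :
    ptr s (cupcap s B * inner B Y) = Y := by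
  rw [ptr_mul_inner, ptr_cupcap hs, one_mul]
theorem ptr_inner_mul_cupcap (hs : s ≠ 0) (Y : M2 B) :
    ptr s (inner B Y * cupcap s B) = Y := by
  rw [ptr_inner_mul, ptr_cupcap hs, mul_one]

theorem ptr_inner (Y : M2 B) : ptr s (inner B Y) = (1 - s ^ 2) • Y := by
  simp [ptr, inner, sub_smul]

theorem ptr_sub (M N : M4 B) : ptr s (M - N) = ptr s M - ptr s N := by
  simp only [ptr, Matrix.sub_apply, smul_sub]; abel

/-- The partial quantum trace is invariant under conjugation by the braiding. -/
theorem ptr_braid_conj (hs : s ≠ 0) (Y : M2 B) :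
    ptr s (braid s B * inner B Y * braidInv s B) = sc (qtr s Y) := by
  rw [braid_inner_braidInv hs, ptr_add, ptr_add, ptr_sub, ptr_smul, ptr_inner,
    ptr_cupcap_mul_inner hs, ptr_inner_mul_cupcap hs, ptr_inner_mul_cupcap hs]
  -- The multiples of `Y` cancel: `(1 - s ^ 2) - 1 + s ^ 2 = 0`.
  module

theorem ptr_braidInv_conj (hs : s ≠ 0) (Y : M2 B) :
    ptr s (braidInv s B * inner B Y * braid s B) = sc (qtr s Y) := by
  rw [braidInv_inner_braid hs, ptr_add, ptr_sub, ptr_add, ptr_smul, ptr_inner,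
    ptr_cupcap_mul_inner hs, ptr_inner_mul_cupcap hs, ptr_inner_mul_cupcap hs]
  module

end matrices

/-! ### Reflection equation, exchange relation and the cut skein relations. -/

section reflection
variable {k B : Type*} [Field k] [Ring B] [Algebra k B] {s : k}

/-- Conjugation of a matrix in the inner factor by the braiding. -/
def up (s : k) (X : M2 B) : M4 B := braid s B * inner B X * braidInv s B

/-- Conjugation of a matrix in the inner factor by the inverse braiding. -/
def dn (s : k) (X : M2 B) : M4 B := braidInv s B * inner B X * braid s B

/-- The exchange relation between the entries of `X` and `Y`. -/
def Exchange (s : k) (X Y : M2 B) : Prop := Commute (inner B X) (up s Y)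

/-- `X` satisfies the reflection equation and has quantum determinant one. -/
structure IsReflection (s : k) (X : M2 B) : Prop where
  reflection : up s X * inner B X = inner B X * dn s X
  det : up s X * inner B X * cupcap s B = cupcap s B

theorem ptr_up (hs : s ≠ 0) (X : M2 B) : ptr s (up s X) = sc (qtr s X) := ptr_braid_conj hs X
theorem smul_dn_add_smul_up (hs : s ≠ 0) (Y : M2 B) :
    s • dn s Y + s⁻¹ • up s Y =
      (s + s⁻¹) • inner B Y + (s * (s ^ 2 - (s ^ 2)⁻¹)) • (cupcap s B * inner B Y)
        + (s + s⁻¹) • (inner B (sc (qtr s Y)) * cupcap s B) := skein_left hs Y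

theorem smul_up_add_smul_dn (hs : s ≠ 0) (Y : M2 B) :
    s • up s Y + s⁻¹ • dn s Y =
      (s + s⁻¹) • inner B Y + (s * (s ^ 2 - (s ^ 2)⁻¹)) • (inner B Y * cupcap s B)
        + (s + s⁻¹) • (inner B (sc (qtr s Y)) * cupcap s B) := skein_right hs Y

theorem up_mul (hs : s ≠ 0) (X Y : M2 B) : up s (X * Y) = up s X * up s Y := by
  have h := braidInv_mul_braid (s := s) (B := B) hs
  simp only [up, map_mul, mul_assoc]
  rw [← mul_assoc (braidInv s B) (braid s B), h, one_mul]

theorem dn_mul (hs : s ≠ 0) (X Y : M2 B) : dn s (X * Y) = dn s X * dn s Y := by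
  have h := braid_mul_braidInv (s := s) (B := B) hs
  simp only [dn, map_mul, mul_assoc]
  rw [← mul_assoc (braid s B) (braidInv s B), h, one_mul]

namespace Exchange
variable {X Y Z : M2 B}

/-- Conjugating the exchange relation by the inverse braiding moves the braiding from `Y` to `X`. -/
theorem commute_dn (hs : s ≠ 0) (h : Exchange s X Y) : Commute (inner B Y) (dn s X) := by
  have e1 := braid_mul_braidInv (s := s) (B := B) hs
  have e2 := braidInv_mul_braid (s := s) (B := B) hs
  have h' : inner B X * (braid s B * inner B Y * braidInv s B) =
    (braid s B * inner B Y * braidInv s B) * inner B X := h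
  have h2 := congrArg (fun M => braidInv s B * M * braid s B) h'
  simp only [mul_assoc, e2, mul_one] at h2
  rw [← mul_assoc (braidInv s B) (braid s B), e2, one_mul] at h2
  show inner B Y * (braidInv s B * inner B X * braid s B) =
    (braidInv s B * inner B X * braid s B) * inner B Y
  simp only [mul_assoc]
  exact h2.symm

theorem one_left : Exchange s 1 Y := by
  rw [Exchange, map_one]; exact Commute.one_left _
theorem mul_left (h₁ : Exchange s X Z) (h₂ : Exchange s Y Z) : Exchange s (X * Y) Z := by
  rw [Exchange, map_mul]; exact Commute.mul_left h₁ h₂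
theorem mul_right (hs : s ≠ 0) (h₁ : Exchange s X Y) (h₂ : Exchange s X Z) :
    Exchange s X (Y * Z) := by
  rw [Exchange, up_mul hs]; exact Commute.mul_right h₁ h₂

/-- The partial quantum trace of the exchange relation: the outer factor of `up s Y` closes to `qtr
s Y`, while `inner B X` passes through the trace. -/
theorem commute_qtr_right (hs : s ≠ 0) (h : Exchange s X Y) : Commute X (sc (qtr s Y)) := by
  have := congrArg (ptr s) (show inner B X * up s Y = up s Y * inner B X from h)
  rwa [ptr_inner_mul, ptr_mul_inner, up, ptr_braid_conj hs] at this

theorem commute_qtr_left (hs : s ≠ 0) (h : Exchange s X Y) : Commute Y (sc (qtr s X)) := by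
  have := congrArg (ptr s) (show inner B Y * dn s X = dn s X * inner B Y from h.commute_dn hs)
  rwa [ptr_inner_mul, ptr_mul_inner, dn, ptr_braidInv_conj hs] at this

end Exchange

theorem Exchange.qtr_mul_qtr_comm {X Y : M2 B} (hs : s ≠ 0) (h : Exchange s X Y) :
    qtr s X * qtr s Y = qtr s Y * qtr s X := by
  rw [← qtr_mul_sc, ← qtr_sc_mul, h.commute_qtr_right hs]

namespace IsReflection
variable {X : M2 B}

/-- By definition of `up` and `dn`, `braid * (inner X * dn X) = (up X * inner X) * braid`. The
reflection equation identifies the two brackets. -/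
theorem commute_braid (hs : s ≠ 0) (h : IsReflection s X) :
    Commute (braid s B) (up s X * inner B X) := by
  have e1 := braid_mul_braidInv (s := s) (B := B) hs
  show braid s B * (up s X * inner B X) = up s X * inner B X * braid s B
  rw [h.reflection]
  nth_rw 1 [← h.reflection]
  rw [up, dn]
  have h' := h.reflection
  rw [up, dn] at h'
  simp only [mul_assoc] at h' ⊢
  rw [h']
  simp only [← mul_assoc] at h' ⊢
  rw [← h']

/-- Since `cupcap = 1 - braid`, it commutes with `up X * inner X`, so the determinant condition also
holds with `cupcap` on the left. -/
theorem cupcap_mul (hs : s ≠ 0) (h : IsReflection s X) :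
    cupcap s B * (up s X * inner B X) = cupcap s B := by
  rw [commute_cupcap_of_commute_braid (h.commute_braid hs), h.det]

end IsReflection

theorem mul_inner_sc_mul_cupcap (M : M4 B) (b : B) :
    M * (inner B (sc b) * cupcap s B) = M * cupcap s B * inner B (sc b) := by
  rw [mul_assoc, cupcap_comm_sc b]

/-- The skein relation with the second strand of the first curve cut open. -/
theorem skein_cut_right {X Y : M2 B} (hs : s ≠ 0) (hX : IsReflection s X) (h : Exchange s X Y) :
    s • (X * sc (qtr s (X * Y))) + s⁻¹ • (sc (qtr s (X * Y)) * X) =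
      (s * (s ^ 2 - (s ^ 2)⁻¹)) • Y + (s + s⁻¹) • (sc (qtr s X) * (X * Y) + sc (qtr s Y)) := by
  -- The trace `qtr (X * Y)` can be opened as `ptr (up _)` or as `ptr (dn _)`. Here `dn` is taken so
  -- that the reflection equation applies, and below `up` so that the exchange relation applies.
  -- Both products then start with `up X * inner X`.
  have e1 : X * sc (qtr s (X * Y)) = ptr s (up s X * inner B X * dn s Y) := by
    rw [← ptr_braidInv_conj hs, ← dn, ← ptr_inner_mul, dn_mul hs, ← mul_assoc, hX.reflection]
  have e2 : sc (qtr s (X * Y)) * X = ptr s (up s X * inner B X * up s Y) := by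
    rw [← ptr_braid_conj hs, ← up, ← ptr_mul_inner, up_mul hs, mul_assoc, mul_assoc, h]
  rw [e1, e2, ← ptr_smul, ← ptr_smul, ← ptr_add, ← mul_smul_comm, ← mul_smul_comm, ← mul_add,
    smul_dn_add_smul_up hs, mul_add, mul_add, mul_smul_comm, mul_smul_comm, mul_smul_comm,
    mul_inner_sc_mul_cupcap, ← mul_assoc _ (cupcap s B), hX.det, ptr_add, ptr_add, ptr_smul,
    ptr_smul, ptr_smul, ptr_mul_inner, ptr_mul_inner, ptr_mul_inner, ptr_cupcap hs,
    ptr_mul_inner, ptr_up hs, one_mul, ptr_cupcap hs, one_mul, mul_assoc]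
  module

/-- The skein relation with the first strand of the second curve cut open. -/
theorem skein_cut_left {X Y : M2 B} (hs : s ≠ 0) (hY : IsReflection s Y) (h : Exchange s X Y) :
    s • (sc (qtr s (X * Y)) * Y) + s⁻¹ • (Y * sc (qtr s (X * Y))) =
      (s * (s ^ 2 - (s ^ 2)⁻¹)) • X + (s + s⁻¹) • (X * sc (qtr s Y) * Y + sc (qtr s X)) := by
  have e1 : sc (qtr s (X * Y)) * Y = ptr s (up s X * (up s Y * inner B Y)) := by
    rw [← ptr_braid_conj hs, ← up, ← ptr_mul_inner, up_mul hs, mul_assoc]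
  -- Mirror image of the other cut: both products now end with `up Y * inner Y`, which absorbs into
  -- `cupcap` from the right.
  have e2 : Y * sc (qtr s (X * Y)) = ptr s (dn s X * (up s Y * inner B Y)) := by
    rw [← ptr_braidInv_conj hs, ← dn, ← ptr_inner_mul, dn_mul hs, ← mul_assoc, h.commute_dn hs,
      mul_assoc, hY.reflection]
  have e3 := hY.cupcap_mul hs
  rw [e1, e2, ← ptr_smul, ← ptr_smul, ← ptr_add, ← smul_mul_assoc, ← smul_mul_assoc, ← add_mul,
    smul_up_add_smul_dn hs, add_mul, add_mul, smul_mul_assoc, smul_mul_assoc, smul_mul_assoc,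
    mul_assoc _ (cupcap s B), mul_assoc _ (cupcap s B), e3, ptr_add, ptr_add, ptr_smul,
    ptr_smul, ptr_smul, ptr_inner_mul_cupcap hs, ptr_inner_mul_cupcap hs, ptr_inner_mul,
    ptr_mul_inner, ptr_up hs, ← mul_assoc]
  module

/-! ### The three skein relations for four mutually exchanging matrices. -/

section four
variable {X₁ X₂ X₃ X₄ : M2 B}

/-- The doubled strand is `X₂`: the relation cut open at `X₂` is placed between `X₁` and `X₄` and
closed by the quantum trace. The exchange relations let the closed traces pass `X₁` and `X₄`, so
that they factor out. -/
theorem skein_one (hs : s ≠ 0) (h₂ : IsReflection s X₂)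
    (h₁₂ : Exchange s X₁ X₂) (h₁₃ : Exchange s X₁ X₃)
    (h₂₃ : Exchange s X₂ X₃) (h₂₄ : Exchange s X₂ X₄) (h₃₄ : Exchange s X₃ X₄) :
    qAnticomm s (qtr s (X₁ * X₂ * X₄)) (qtr s (X₂ * X₃)) =
      (s * (s ^ 2 - (s ^ 2)⁻¹)) • qtr s (X₁ * X₃ * X₄) +
        (s + s⁻¹) • (qtr s X₂ * qtr s (X₁ * X₂ * X₃ * X₄) + qtr s (X₁ * X₄) * qtr s X₃) := by
  have c₁ := (h₁₂.mul_right hs h₁₃).commute_qtr_right hs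
  have c₄ := (h₂₄.mul_left h₃₄).commute_qtr_left hs
  have d₁ := h₁₂.commute_qtr_right hs
  have d₄ := h₃₄.commute_qtr_left hs
  have := congrArg (fun M => qtr s (X₁ * M * X₄)) (skein_cut_right hs h₂ h₂₃)
  simp only [mul_add, add_mul, mul_smul_comm, smul_mul_assoc, smul_add, qtr_add, qtr_smul] at this
  rw [← mul_assoc X₁ X₂, mul_assoc _ _ X₄, ← c₄.eq, ← mul_assoc _ X₄, qtr_mul_sc,
    ← mul_assoc X₁ (sc _) X₂, c₁.eq, mul_assoc (sc _), mul_assoc (sc _), qtr_sc_mul,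
    ← mul_assoc X₁ (sc _), d₁.eq, mul_assoc (sc _), mul_assoc (sc _), qtr_sc_mul,
    mul_assoc X₁ (sc _), ← d₄.eq, ← mul_assoc X₁ X₄, qtr_mul_sc, ← mul_assoc X₁ X₂ X₃] at this
  rw [qAnticomm, smul_add, this]

/-- As in `skein_one`, with the doubled strand `X₃` and the mirror-image cut. -/
theorem skein_two (hs : s ≠ 0) (h₃ : IsReflection s X₃)
    (h₁₂ : Exchange s X₁ X₂) (h₁₃ : Exchange s X₁ X₃)
    (h₂₃ : Exchange s X₂ X₃) (h₂₄ : Exchange s X₂ X₄) (h₃₄ : Exchange s X₃ X₄) :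
    qAnticomm s (qtr s (X₂ * X₃)) (qtr s (X₁ * X₃ * X₄)) =
      (s * (s ^ 2 - (s ^ 2)⁻¹)) • qtr s (X₁ * X₂ * X₄) +
        (s + s⁻¹) • (qtr s X₃ * qtr s (X₁ * X₂ * X₃ * X₄) + qtr s X₂ * qtr s (X₁ * X₄)) := by
  have c₁ := (h₁₂.mul_right hs h₁₃).commute_qtr_right hs
  have c₄ := (h₂₄.mul_left h₃₄).commute_qtr_left hs
  have d₁ := h₁₃.commute_qtr_right hs
  have d₂ := h₂₃.commute_qtr_right hs
  have d₃ := h₁₂.commute_qtr_right hs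
  have := congrArg (fun M => qtr s (X₁ * M * X₄)) (skein_cut_left hs h₃ h₂₃)
  simp only [mul_add, add_mul, mul_smul_comm, smul_mul_assoc, smul_add, qtr_add, qtr_smul] at this
  rw [d₂.eq, ← mul_assoc X₁ (sc _) X₃, c₁.eq, mul_assoc (sc _), mul_assoc (sc _), qtr_sc_mul,
    ← mul_assoc X₁ X₃ (sc _), mul_assoc _ (sc _) X₄, ← c₄.eq, ← mul_assoc _ X₄, qtr_mul_sc,
    mul_assoc (sc _) X₂ X₃, ← mul_assoc X₁ (sc _), d₁.eq, mul_assoc (sc _), mul_assoc (sc _),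
    qtr_sc_mul, d₃.eq, mul_assoc (sc _), qtr_sc_mul, ← mul_assoc X₁ X₂ X₃] at this
  rw [qAnticomm, smul_add, this]

theorem qtr_ptr_braid_mul (hs : s ≠ 0) (M : M4 B) :
    qtr s (ptr s (braid s B * M)) = qtr s (ptr s (M * braid s B)) := by
  have e (P Q : M2 B) : qtr s (P - Q) = qtr s P - qtr s Q := by
    simp only [qtr, Matrix.sub_apply, smul_sub]; abel
  rw [braid, sub_mul, mul_sub, ptr_sub, ptr_sub, e, e, qtr_ptr_cupcap_mul hs, one_mul, mul_one]

/-- Writes a product of traces as one double trace, in which both factors can be manipulated at the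
same time. -/
theorem qtr_mul_qtr (hs : s ≠ 0) (X Y : M2 B) :
    qtr s X * qtr s Y = qtr s (ptr s (up s X * inner B Y)) := by
  rw [ptr_mul_inner, up, ptr_braid_conj hs, qtr_sc_mul]

/-- Here `X₁` and `X₄` are both doubled and surround the crossing, so no single cut suffices. In the
double trace they collect into `Z₁ = up X₁ * inner X₁` on the left and `Z₄ = up X₄ * inner X₄` on
the right. Both commute with the braiding and are deleted by `cupcap`. -/
theorem skein_three (hs : s ≠ 0) (h₁ : IsReflection s X₁) (h₄ : IsReflection s X₄)
    (h₁₂ : Exchange s X₁ X₂) (h₁₃ : Exchange s X₁ X₃) (h₁₄ : Exchange s X₁ X₄)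
    (h₂₃ : Exchange s X₂ X₃) (h₂₄ : Exchange s X₂ X₄) (h₃₄ : Exchange s X₃ X₄) :
    qAnticomm s (qtr s (X₁ * X₃ * X₄)) (qtr s (X₁ * X₂ * X₄)) =
      (s * (s ^ 2 - (s ^ 2)⁻¹)) • qtr s (X₂ * X₃) +
        (s + s⁻¹) • (qtr s (X₁ * X₄) * qtr s (X₁ * X₂ * X₃ * X₄) + qtr s X₃ * qtr s X₂) := by
  have e1 : up s (X₁ * X₃ * X₄) * inner B (X₁ * X₂ * X₄) =
      up s X₁ * inner B X₁ * inner B X₂ * up s X₃ * (up s X₄ * inner B X₄) := by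
    have a : inner B X₁ * up s X₃ = up s X₃ * inner B X₁ := h₁₃
    have b : inner B X₁ * up s X₄ = up s X₄ * inner B X₁ := h₁₄
    have c : inner B X₂ * up s X₃ = up s X₃ * inner B X₂ := h₂₃
    have d : inner B X₂ * up s X₄ = up s X₄ * inner B X₂ := h₂₄
    simp only [up_mul hs, map_mul, mul_assoc]
    rw [← mul_assoc (inner B X₂) (up s X₃), c, mul_assoc, ← mul_assoc (inner B X₁) (up s X₃), a,
      ← mul_assoc (inner B X₂) (up s X₄), d, mul_assoc, mul_assoc,
      ← mul_assoc (inner B X₁) (up s X₄), b, mul_assoc]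
  have e2 : up s (X₁ * X₂ * X₄) * inner B (X₁ * X₃ * X₄) =
      up s X₁ * inner B X₁ * up s X₂ * inner B X₃ * (up s X₄ * inner B X₄) := by
    have a : inner B X₁ * up s X₂ = up s X₂ * inner B X₁ := h₁₂
    have b : inner B X₁ * up s X₄ = up s X₄ * inner B X₁ := h₁₄
    have d : inner B X₃ * up s X₄ = up s X₄ * inner B X₃ := h₃₄
    simp only [up_mul hs, map_mul, mul_assoc]
    rw [← mul_assoc (inner B X₃) (up s X₄), d, mul_assoc, ← mul_assoc (inner B X₁) (up s X₂), a,
      mul_assoc, ← mul_assoc (inner B X₁) (up s X₄), b, mul_assoc]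
  have e3 : up s (X₁ * X₄) * inner B (X₁ * X₂ * X₃ * X₄) =
      up s X₁ * inner B X₁ * inner B X₂ * inner B X₃ * (up s X₄ * inner B X₄) := by
    have a : inner B X₁ * up s X₄ = up s X₄ * inner B X₁ := h₁₄
    have b : inner B X₂ * up s X₄ = up s X₄ * inner B X₂ := h₂₄
    have d : inner B X₃ * up s X₄ = up s X₄ * inner B X₃ := h₃₄
    simp only [up_mul hs, map_mul, mul_assoc]
    rw [← mul_assoc (inner B X₃) (up s X₄), d, mul_assoc, ← mul_assoc (inner B X₂) (up s X₄), b,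
      mul_assoc, ← mul_assoc (inner B X₁) (up s X₄), a, mul_assoc]
  have k1 := h₁.commute_braid hs
  have k4 := h₄.commute_braid hs
  have z1 := h₁.cupcap_mul hs
  have z4 := h₄.cupcap_mul hs
  have w4 := h₄.det
  obtain ⟨Z₁, hZ₁⟩ : ∃ Z, Z = up s X₁ * inner B X₁ := ⟨_, rfl⟩
  obtain ⟨Z₄, hZ₄⟩ : ∃ Z, Z = up s X₄ * inner B X₄ := ⟨_, rfl⟩
  rw [← hZ₁] at k1 z1 e1 e2 e3
  rw [← hZ₄] at k4 z4 w4 e1 e2 e3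
  -- The other order of multiplication has `up X₂ * inner X₃` in the middle. Its leading `braid`
  -- commutes past `Z₁`, goes around the trace by cyclicity and returns through `Z₄`, which leaves
  -- `inner X₂ * dn X₃`.
  have e2' : qtr s (ptr s (up s (X₁ * X₂ * X₄) * inner B (X₁ * X₃ * X₄))) =
      qtr s (ptr s (Z₁ * inner B X₂ * dn s X₃ * Z₄)) := by
    have : up s (X₁ * X₂ * X₄) * inner B (X₁ * X₃ * X₄) =
        braid s B * (Z₁ * inner B X₂ * braidInv s B * inner B X₃ * Z₄) := by
      rw [e2, up]
      simp only [← mul_assoc]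
      rw [k1.eq]
    rw [this, qtr_ptr_braid_mul hs, mul_assoc _ Z₄, ← k4.eq, dn]
    simp only [mul_assoc]
  rw [qAnticomm, qtr_mul_qtr hs, qtr_mul_qtr hs, e2', e1, ← qtr_smul, ← qtr_smul, ← ptr_smul,
    ← ptr_smul, ← qtr_add, ← ptr_add, ← smul_mul_assoc _ _ Z₄, ← smul_mul_assoc _ _ Z₄, ← add_mul,
    ← mul_smul_comm, ← mul_smul_comm, ← mul_add, smul_up_add_smul_dn hs]
  -- `cupcap` deletes `Z₄`, moves around the trace to the front and deletes `Z₁`.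
  have f1 : qtr s (ptr s (Z₁ * inner B X₂ * (inner B X₃ * cupcap s B) * Z₄)) =
      qtr s (X₂ * X₃) := by
    rw [← mul_assoc, mul_assoc _ (cupcap s B), z4, ← qtr_ptr_cupcap_mul hs]
    simp only [← mul_assoc]
    rw [z1, mul_assoc, ← map_mul, ptr_cupcap_mul_inner hs]
  have f2 : qtr s (ptr s (Z₁ * inner B X₂ * (inner B (sc (qtr s X₃)) * cupcap s B) * Z₄)) =
      qtr s X₃ * qtr s X₂ := by
    rw [← mul_assoc, mul_assoc _ (cupcap s B), z4, ← qtr_ptr_cupcap_mul hs]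
    simp only [← mul_assoc]
    rw [z1, mul_assoc, ← map_mul, ptr_cupcap_mul_inner hs, qtr_mul_sc, h₂₃.qtr_mul_qtr_comm hs]
  have f3 : qtr s (X₁ * X₄) * qtr s (X₁ * X₂ * X₃ * X₄) =
      qtr s (ptr s (Z₁ * inner B X₂ * inner B X₃ * Z₄)) := by
    rw [qtr_mul_qtr hs, e3]
  simp only [mul_add, add_mul, mul_smul_comm, smul_mul_assoc, ptr_add, qtr_add, ptr_smul, qtr_smul,
    f1, f2, f3]
  module

end four
end reflection

/-! ### The reflection equation in matrix entries. -/

section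
variable {k B : Type*} [Field k] [Ring B] [Algebra k B] {s : k}

theorem up_eq (hs : s ≠ 0) (a b c d : B) : up s !![a, b; c, d] =
    !![!![a, b + s ^ 2 • b; 0, a], !![b, 0; 0, -((s ^ 2)⁻¹ • b)];
       !![c, d - s ^ 2 • a + s ^ 2 • d - a; 0, -(s ^ 2 • c)], !![d, b + (s ^ 2)⁻¹ • b; 0, d]] := by
  rw [up, braid_inner_braidInv hs]
  ext i j i' j'
  fin_cases i <;> fin_cases j <;> fin_cases i' <;> fin_cases j' <;>
  simp [cupcap, inner, qtr, Matrix.add_apply, Matrix.sub_apply, smul_sub, smul_smul, hs]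
  abel

theorem dn_eq (hs : s ≠ 0) (a b c d : B) : dn s !![a, b; c, d] =
    !![!![a, 0; c + s ^ 2 • c, a],
        !![-((s ^ 2)⁻¹ • b), 0; a - (s ^ 2)⁻¹ • d + (s ^ 2)⁻¹ • a - d, b];
       !![-(s ^ 2 • c), 0; 0, c], !![d, 0; c + (s ^ 2)⁻¹ • c, d]] := by
  rw [dn, braidInv_inner_braid hs]
  ext i j i' j'
  fin_cases i <;> fin_cases j <;> fin_cases i' <;> fin_cases j' <;>
  simp [cupcap, inner, qtr, Matrix.add_apply, Matrix.sub_apply, smul_sub, smul_smul, hs]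
  abel

/-- The reflection equation and the quantum determinant, in terms of matrix entries. -/
theorem isReflection_of_entries (hs : s ≠ 0) {a b c d : B}
    (hda : d * a = a * d) (hbd : b * d = -(s ^ 2 • (d * b)))
    (hcd : c * d = -((s ^ 2)⁻¹ • (d * c)))
    (hba : b * a = a * b - (s ^ 2 * (1 + s ^ 2)) • (d * b))
    (hca : c * a = a * c - (s ^ 2 + 1) • (d * c))
    (hbc : b * c = s ^ 2 • (1 - a * d))
    (hcb : c * b = a * d - (s ^ 2 + 1) • (d * d) + s ^ 2 • 1) :
    IsReflection s !![a, b; c, d] := by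
  constructor
  · rw [up_eq hs, dn_eq hs]
    ext i j i' j'
    fin_cases i <;> fin_cases j <;> fin_cases i' <;> fin_cases j' <;>
      simp [inner, Matrix.mul_apply, Fin.sum_univ_two, mul_add, add_mul, mul_sub, sub_mul,
        smul_smul, hda, hbd, hcd, hba, hca, hbc, hcb] <;>
    match_scalars <;> field_simp <;> ring
  · rw [up_eq hs, cupcap]
    ext i j i' j'
    fin_cases i <;> fin_cases j <;> fin_cases i' <;> fin_cases j' <;>
      simp [inner, Matrix.mul_apply, Fin.sum_univ_two, mul_add, add_mul, mul_sub, sub_mul,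
        smul_smul, hda, hbd, hcd, hba, hca, hbc, hcb] <;>
    match_scalars <;> field_simp <;> ring
end


/-! ### Relations in `I_R`, functoriality, and dressing by an `L`-operator. -/

section
variable {k B C : Type*} [Field k] [Ring B] [Algebra k B] [Ring C] [Algebra k C] {s : k}

/-- The reflection equation from the relations between the generators of `I_R`. -/
theorem isReflection_of_relations (hs : IsGeneric s) {x y z c : B}
    (hxc : x * c = c * x) (hyc : y * c = c * y) (hzc : z * c = c * z)
    (hyx : y * x = -(s ^ 2 • (x * y))) (hzx : z * x = -((s ^ 2)⁻¹ • (x * z)))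
    (hzy : z * y = s⁻¹ • (-(c * x) + (s ^ 2 - (s ^ 2)⁻¹)⁻¹ • (s⁻¹ • (x * x) - s • 1)))
    (hyz : y * z = s • (c * x + (s ^ 2 - (s ^ 2)⁻¹)⁻¹ • (s • (x * x) - s⁻¹ • 1))) :
    IsReflection s !![s ^ 2 • x + (s * (s ^ 2 - (s ^ 2)⁻¹)) • c, y;
      -((s ^ 2 * (s ^ 2 - (s ^ 2)⁻¹)) • z), x] := by
  have h0 := hs.1
  have e : s ^ 2 - (s ^ 2)⁻¹ ≠ 0 := by
    intro h
    have := mul_ne_zero hs.h1 hs.h2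
    field_simp at h
    exact this (by linear_combination h)
  -- Only `t ≠ 0` is needed, not the value of `t`: the factors of `t` in the entries cancel against
  -- `t⁻¹` in the relations.
  obtain ⟨t, ht⟩ : ∃ t, t = s ^ 2 - (s ^ 2)⁻¹ := ⟨_, rfl⟩
  rw [← ht] at hzy hyz e ⊢
  apply isReflection_of_entries h0 <;>
    simp only [mul_add, add_mul, mul_sub, sub_mul, smul_mul_assoc, mul_smul_comm, mul_neg, neg_mul,
      hxc, hyc, hzc, hyx, hzx, hzy, hyz] <;>
    match_scalars <;> field_simp <;> ring

/-- Entrywise application of a morphism. -/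
def map4 (f : B →ₐ[k] C) : M4 B →ₐ[k] M4 C := f.mapMatrix.mapMatrix

variable (f : B →ₐ[k] C)

theorem map4_inner (X : M2 B) : map4 f (inner B X) = inner C (f.mapMatrix X) := by
  ext i j i' j'
  fin_cases i <;> fin_cases j <;> fin_cases i' <;> fin_cases j' <;> simp [map4, inner]

theorem map4_outer (X : M2 B) : map4 f (outer B X) = outer C (f.mapMatrix X) := by
  ext i j i' j'
  fin_cases i <;> fin_cases j <;> fin_cases i' <;> fin_cases j' <;> simp [map4, outer]

theorem map4_cupcap : map4 f (cupcap s B) = cupcap s C := by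
  ext i j i' j'
  fin_cases i <;> fin_cases j <;> fin_cases i' <;> fin_cases j' <;> simp [map4, cupcap]

theorem map4_braid : map4 f (braid s B) = braid s C := by
  rw [braid, map_sub, map_one, map4_cupcap, braid]

theorem map4_braidInv : map4 f (braidInv s B) = braidInv s C := by
  rw [braidInv, map_add, map_one, map_smul, map4_cupcap, braidInv]

theorem map4_up (X : M2 B) : map4 f (up s X) = up s (f.mapMatrix X) := by
  rw [up, map_mul, map_mul, map4_braid, map4_braidInv, map4_inner, up]

theorem map4_dn (X : M2 B) : map4 f (dn s X) = dn s (f.mapMatrix X) := by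
  rw [dn, map_mul, map_mul, map4_braid, map4_braidInv, map4_inner, dn]

theorem IsReflection.map {X : M2 B} (h : IsReflection s X) : IsReflection s (f.mapMatrix X) where
  reflection := by rw [← map4_up, ← map4_dn, ← map4_inner, ← map_mul, ← map_mul, h.reflection]
  det := by rw [← map4_up, ← map4_inner, ← map4_cupcap f, ← map_mul, ← map_mul, h.det]

/-- All entries of `X` commute with all entries of `Y`. -/
def EntriesCommute (X Y : M2 B) : Prop := ∀ i j i' j', Commute (X i j) (Y i' j')

theorem EntriesCommute.outer_inner {X Y : M2 B} (h : EntriesCommute X Y) :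
    Commute (outer B X) (inner B Y) := by
  ext i j i' j'
  have := h i j i' j'
  fin_cases i <;> fin_cases j <;> fin_cases i' <;> fin_cases j' <;>
    simpa [inner, outer, Matrix.mul_apply, Fin.sum_univ_two] using this.eq

/-- The exchange relations of an `L`-operator `T` with itself and with `X`. -/
structure IsLOp (s : k) (T T' X : M2 B) : Prop where
  mul_inv : T * T' = 1
  inv_mul : T' * T = 1
  rtt : braid s B * (outer B T * inner B T) = outer B T * inner B T * braid s B
  rxt : outer B X * inner B T = inner B T * dn s X

theorem IsLOp.map {T T' X : M2 B} (h : IsLOp s T T' X) :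
    IsLOp s (f.mapMatrix T) (f.mapMatrix T') (f.mapMatrix X) where
  mul_inv := by rw [← map_mul, h.mul_inv, map_one]
  inv_mul := by rw [← map_mul, h.inv_mul, map_one]
  rtt := by
    rw [← map4_outer, ← map4_inner, ← map4_braid f, ← map_mul, ← map_mul, h.rtt, map_mul]
  rxt := by
    rw [← map4_outer, ← map4_inner, ← map4_dn f, ← map_mul, h.rxt, map_mul]

/-- Converse of `Exchange.commute_dn`, by conjugating back. It is needed because the `L`-operator
relation `rxt` describes `dn`, not `up`. -/
theorem exchange_of_commute_dn (hs : s ≠ 0) {X Y : M2 B} (h : Commute (inner B Y) (dn s X)) :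
    Exchange s X Y := by
  have e1 := braid_mul_braidInv (s := s) (B := B) hs
  have e2 := braidInv_mul_braid (s := s) (B := B) hs
  have h2 := congrArg (fun M => braid s B * M * braidInv s B)
    (show inner B Y * (braidInv s B * inner B X * braid s B) =
      (braidInv s B * inner B X * braid s B) * inner B Y from h)
  simp only [mul_assoc, e1, mul_one] at h2
  rw [← mul_assoc (braid s B) (braidInv s B), e1, one_mul] at h2
  show inner B X * (braid s B * inner B Y * braidInv s B) =
    (braid s B * inner B Y * braidInv s B) * inner B X
  simp only [mul_assoc]
  exact h2.symm

variable {T T' K X Y : M2 B}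

/-- The matrix `K` exchanges with a matrix dressed by the `L`-operator. -/
theorem IsLOp.exchange_left (hs : s ≠ 0) (h : IsLOp s T T' K) (hK : EntriesCommute K Y) :
    Exchange s K (T' * Y * T) := by
  have e3 : inner B T' * inner B T = 1 := by rw [← map_mul, h.inv_mul, map_one]
  have e4 : inner B T * inner B T' = 1 := by rw [← map_mul, h.mul_inv, map_one]
  -- By `rxt`, braiding `K` amounts to dressing its copy in the outer factor. Both matrices are then
  -- conjugates by `inner T`, of `outer K` and of `inner Y`, which commute.
  have e : dn s K = inner B T' * outer B K * inner B T := by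
    rw [mul_assoc, h.rxt, ← mul_assoc, e3, one_mul]
  apply exchange_of_commute_dn hs
  rw [e, map_mul, map_mul]
  show _ * _ = _ * _
  simp only [mul_assoc]
  rw [← mul_assoc (inner B T) (inner B T'), e4, one_mul, ← mul_assoc (inner B T) (inner B T'), e4,
    one_mul, ← mul_assoc (inner B Y), ← hK.outer_inner.eq, mul_assoc]

/-- Dressing by the `L`-operator preserves the exchange relations. -/
theorem IsLOp.exchange_conj (hs : s ≠ 0) (h : IsLOp s T T' K) (hX : EntriesCommute T X)
    (hY : EntriesCommute T Y) (hXY : Exchange s X Y) :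
    Exchange s (T' * X * T) (T' * Y * T) := by
  have i1 := braid_mul_braidInv (s := s) (B := B) hs
  have i2 := braidInv_mul_braid (s := s) (B := B) hs
  -- Dressing is conjugation by `S`: the extra factor `outer T` passes `inner Z` and cancels. By
  -- RTT, `S` commutes with the braiding, so conjugation by `S` is compatible with `up`.
  obtain ⟨S, hS⟩ : ∃ S, S = outer B T * inner B T := ⟨_, rfl⟩
  obtain ⟨S', hS'⟩ : ∃ S', S' = inner B T' * outer B T' := ⟨_, rfl⟩
  have e1 : S' * S = 1 := by
    rw [hS, hS', mul_assoc, ← mul_assoc (outer B T'), ← map_mul, h.inv_mul, map_one, one_mul,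
      ← map_mul, h.inv_mul, map_one]
  have e2 : S * S' = 1 := by
    rw [hS, hS', mul_assoc, ← mul_assoc (inner B T), ← map_mul, h.mul_inv, map_one, one_mul,
      ← map_mul, h.mul_inv, map_one]
  have c1 : braid s B * S = S * braid s B := by rw [hS]; exact h.rtt
  have dress (Z : M2 B) (hZ : EntriesCommute T Z) :
      inner B (T' * Z * T) = S' * inner B Z * S := by
    rw [hS, hS', map_mul, map_mul]
    simp only [mul_assoc]
    rw [← mul_assoc (inner B Z), ← hZ.outer_inner.eq, mul_assoc, ← mul_assoc (outer B T'),
      ← map_mul (outer B), h.inv_mul, map_one, one_mul]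
  have c2 : S' * braid s B = braid s B * S' := by
    calc S' * braid s B = S' * (braid s B * S) * S' := by simp only [mul_assoc, e2, mul_one]
      _ = S' * S * (braid s B * S') := by rw [c1]; simp only [mul_assoc]
      _ = _ := by rw [e1, one_mul]
  have c3 : S * braidInv s B = braidInv s B * S := by
    calc S * braidInv s B = braidInv s B * (braid s B * S) * braidInv s B := by
          rw [← mul_assoc (braidInv s B), i2, one_mul]
      _ = braidInv s B * S * (braid s B * braidInv s B) := by rw [c1]; simp only [mul_assoc]
      _ = _ := by rw [i1, mul_one]
  have eY : up s (T' * Y * T) = S' * up s Y * S := by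
    rw [up, dress Y hY, up]
    simp only [mul_assoc]
    rw [c3, ← mul_assoc (braid s B) S', ← c2]
    simp only [mul_assoc]
  rw [Exchange, dress X hX, eY]
  show _ * _ = _ * _
  have hXY' : inner B X * up s Y = up s Y * inner B X := hXY
  calc S' * inner B X * S * (S' * up s Y * S) = S' * (inner B X * (S * S') * up s Y) * S := by
        simp only [mul_assoc]
    _ = S' * (up s Y * (S * S') * inner B X) * S := by rw [e2, mul_one, mul_one, hXY']
    _ = _ := by simp only [mul_assoc]

end

/-! ### The reflection matrix and the `L`-operator over `osp_q(1|2)`. -/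

noncomputable section
open Osp Algebra.TensorProduct
variable {k : Type*} [Field k] (s : k)

/-- The matrix of the generators of `I_R`. -/
def IRMat : M2 (IR s) :=
  !![s ^ 2 • IR.KsqP s + (s * (s ^ 2 - (s ^ 2)⁻¹)) • IR.cas s, IR.AmK s;
     -((s ^ 2 * (s ^ 2 - (s ^ 2)⁻¹)) • IR.ApK s), IR.KsqP s]

/-- The triangular `L`-operator over `osp_q(1|2)`. -/
def lMat : M2 (Osp k s) :=
  !![Kinv s ^ 2 * P s, 0; (s ^ 2 - (s ^ 2)⁻¹) • (Ap s * Kinv s * P s), 1]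

/-- The inverse of the triangular `L`-operator. -/
def lMatInv : M2 (Osp k s) :=
  !![K s ^ 2 * P s, 0; -((s ^ 2 - (s ^ 2)⁻¹) • (Ap s * K s)), 1]

variable {s}

theorem generator_relations (h : IsGeneric s) :
    let x := K s ^ 2 * P s
    let y := Am s * K s
    let z := Ap s * K s
    let c := casimir s
    y * x = -(s ^ 2 • (x * y)) ∧ z * x = -((s ^ 2)⁻¹ • (x * z)) ∧
    z * y = s⁻¹ • (-(c * x) + (s ^ 2 - (s ^ 2)⁻¹)⁻¹ • (s⁻¹ • (x * x) - s • 1)) ∧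
    y * z = s • (c * x + (s ^ 2 - (s ^ 2)⁻¹)⁻¹ • (s • (x * x) - s⁻¹ • 1)) := by
  have hs := h.1; have := h.h1; have := h.h2
  intro x y z c
  simp only [x, y, z, c]
  refine ⟨?_, ?_, ?_, ?_⟩
  all_goals
    try simp only [casimir, h.e2]
    simp only [h.e1, sq, mul_add, add_mul,
      mul_sub, sub_mul, smul_mul_assoc, mul_smul_comm, mul_assoc, smul_sub, smul_add, neg_mul,
      mul_neg, smul_neg, smul_smul, neg_neg, sub_neg_eq_add, mul_one, one_mul,
      KA, KM, kA hs, kM hs, PA, PM, PK, Pk, PP, MA, K_mul_Kinv, Kinv_mul_K,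
      KA', KM', kA' _ hs, kM' _ hs, PA', PM', PK', Pk', PP', MA', Kk', kK']
    all_goals match_scalars
    all_goals try field_simp
    all_goals try ring

theorem isReflection_IRMat (h : IsGeneric s) : IsReflection s (IRMat s) := by
  obtain ⟨h1, h2, h3, h4⟩ := generator_relations h
  exact isReflection_of_relations h (Subtype.ext (casimir_comm' h _).symm)
    (Subtype.ext (casimir_comm' h _).symm) (Subtype.ext (casimir_comm' h _).symm)
    (Subtype.ext h1) (Subtype.ext h2) (Subtype.ext h3) (Subtype.ext h4)

/-- `lMat` is the triangular matrix whose conjugation produces the prescribed values of `τ_R`. Each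
of its exchange relations, taken entry by entry, follows by normal ordering in `osp_q(1|2)`. -/
theorem isLOp_lMat (h : IsGeneric s) :
    IsLOp s (lMat s) (lMatInv s) ((IR s).val.mapMatrix (IRMat s)) := by
  have hs := h.1; have := h.h1; have := h.h2
  have e : (IR s).val.mapMatrix (IRMat s) =
      !![s ^ 2 • (K s ^ 2 * P s) + (s * (s ^ 2 - (s ^ 2)⁻¹)) • casimir s, Am s * K s;
        -((s ^ 2 * (s ^ 2 - (s ^ 2)⁻¹)) • (Ap s * K s)), K s ^ 2 * P s] := by
    ext i j
    fin_cases i <;> fin_cases j <;> rfl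
  rw [e]
  refine ⟨?_, ?_, ?_, ?_⟩
  · ext i j
    fin_cases i <;> fin_cases j <;> simp [lMat, lMatInv, Matrix.mul_apply, Fin.sum_univ_two]
    all_goals
      simp only [sq, mul_add, add_mul,
        mul_sub, sub_mul, smul_mul_assoc, mul_smul_comm, mul_assoc, smul_sub, smul_add, neg_mul,
        mul_neg, smul_neg, smul_smul, neg_neg, sub_neg_eq_add, mul_one, one_mul,
        KA, KM, kA hs, kM hs, PA, PM, PK, Pk, PP, MA, K_mul_Kinv, Kinv_mul_K,
        KA', KM', kA' _ hs, kM' _ hs, PA', PM', PK', Pk', PP', MA', Kk', kK']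
      try match_scalars <;> field_simp <;> ring
  · ext i j
    fin_cases i <;> fin_cases j <;> simp [lMat, lMatInv, Matrix.mul_apply, Fin.sum_univ_two]
    all_goals
      simp only [sq, mul_add, add_mul,
        mul_sub, sub_mul, smul_mul_assoc, mul_smul_comm, mul_assoc, smul_sub, smul_add, neg_mul,
        mul_neg, smul_neg, smul_smul, neg_neg, sub_neg_eq_add, mul_one, one_mul,
        KA, KM, kA hs, kM hs, PA, PM, PK, Pk, PP, MA, K_mul_Kinv, Kinv_mul_K,
        KA', KM', kA' _ hs, kM' _ hs, PA', PM', PK', Pk', PP', MA', Kk', kK']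
      try match_scalars <;> field_simp <;> ring
  · rw [braid, cupcap]
    ext i j i' j'
    fin_cases i <;> fin_cases j <;> fin_cases i' <;> fin_cases j' <;>
      simp [inner, outer, lMat, Matrix.mul_apply, Fin.sum_univ_two, Matrix.sub_apply, sub_mul,
        mul_sub, Matrix.vecMul, dotProduct]
    all_goals
      try simp only [casimir, h.e2]
      simp only [h.e1, sq, mul_add, add_mul,
        mul_sub, sub_mul, smul_mul_assoc, mul_smul_comm, mul_assoc, smul_sub, smul_add, neg_mul,
        mul_neg, smul_neg, smul_smul, neg_neg, sub_neg_eq_add, mul_one, one_mul,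
        KA, KM, kA hs, kM hs, PA, PM, PK, Pk, PP, MA, K_mul_Kinv, Kinv_mul_K,
        KA', KM', kA' _ hs, kM' _ hs, PA', PM', PK', Pk', PP', MA', Kk', kK']
      try match_scalars <;> field_simp <;> ring
  · rw [dn_eq hs]
    ext i j i' j'
    fin_cases i <;> fin_cases j <;> fin_cases i' <;> fin_cases j' <;>
      simp [inner, outer, lMat, Matrix.mul_apply, Fin.sum_univ_two]
    all_goals
      try simp only [casimir, h.e2]
      simp only [h.e1, sq, mul_add, add_mul,
        mul_sub, sub_mul, smul_mul_assoc, mul_smul_comm, mul_assoc, smul_sub, smul_add, neg_mul,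
        mul_neg, smul_neg, smul_smul, neg_neg, sub_neg_eq_add, mul_one, one_mul,
        KA, KM, kA hs, kM hs, PA, PM, PK, Pk, PP, MA, K_mul_Kinv, Kinv_mul_K,
        KA', KM', kA' _ hs, kM' _ hs, PA', PM', PK', Pk', PP', MA', Kk', kK']
      try match_scalars <;> field_simp <;> ring

end

/-! ### Counit, and the action of `Δ` and `τ_R` on the reflection matrix. -/

noncomputable section
open Osp Algebra.TensorProduct

section
variable {k : Type*} [Field k] {s : k}

theorem coproductR_gens (h : IsGeneric s) :
    coproductR h (IR.ApK s) = (Ap s * K s) ⊗ₜ IR.KsqP s + 1 ⊗ₜ IR.ApK s ∧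
    coproductR h (IR.AmK s) = (Am s * K s) ⊗ₜ IR.KsqP s + 1 ⊗ₜ IR.AmK s ∧
    coproductR h (IR.KsqP s) = (K s ^ 2 * P s) ⊗ₜ IR.KsqP s ∧
    coproductR h (IR.cas s) = casimir s ⊗ₜ IR.KsqP s + (Kinv s ^ 2 * P s) ⊗ₜ IR.cas s
      + ((s ^ 2 - (s ^ 2)⁻¹)⁻¹ * (s - s⁻¹)) • ((Kinv s ^ 2 * P s) ⊗ₜ IR.KsqP s)
      + s⁻¹ • ((Ap s * Kinv s * P s) ⊗ₜ IR.AmK s)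
      - s • ((Am s * Kinv s * P s) ⊗ₜ IR.ApK s) := by
  obtain ⟨dA, dM, dK, dk, dP⟩ := coproduct_gens h
  obtain ⟨c1, c2, c3, c4⟩ := coproduct_formulas h
  have t (a : Osp k s) (b : IR s) : inclIR s (a ⊗ₜ b) = a ⊗ₜ (b : Osp k s) := rfl
  have spec (v : IR s) : inclIR s (coproductR h v) = coproduct h v :=
    congrArg (fun φ : IR s →ₐ[k] _ => φ v) (coproductR_spec h)
  refine ⟨inclIR_injective ?_, inclIR_injective ?_, inclIR_injective ?_, inclIR_injective ?_⟩
  · rw [spec]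
    change coproduct h (Ap s * K s) = _
    rw [map_mul, dA, dK, c1]; simp only [map_add, t]; rfl
  · rw [spec]
    change coproduct h (Am s * K s) = _
    rw [map_mul, dM, dK, c2]; simp only [map_add, t]; rfl
  · rw [spec]
    change coproduct h (K s ^ 2 * P s) = _
    rw [map_mul, map_pow, dK, dP, c3]; rfl
  · rw [spec]
    change coproduct h (casimir s) = _
    rw [casimir, map_mul, map_add, map_neg, map_smul, map_sub, map_smul, map_smul, map_mul,
      map_pow, map_pow, dA, dM, dK, dk, dP, c4]
    simp only [map_add, map_sub, map_smul, t]; rfl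

theorem counit_relations (s : k) : Relations s (0 : k) 0 1 1 1 := by
  constructor <;> simp

variable (s) in
/-- The counit of `osp_q(1|2)`. -/
def counit : Osp k s →ₐ[k] k := Osp.lift 0 0 1 1 1 (counit_relations s)

variable (s) in
/-- The counit, restricted to `I_R`. -/
def counitR : IR s →ₐ[k] k := (counit s).comp (IR s).val

/-- This value is the conventional `Γ^q_∅`, so the empty set needs no separate treatment in the
relations. -/
theorem counit_casimir (h : IsGeneric s) : counitR s (IR.cas s) = -(s + s⁻¹)⁻¹ := by
  obtain ⟨e1, e2, e3, e4, e5⟩ := lift_gens _ _ _ _ _ (counit_relations s)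
  change counit s (casimir s) = _
  rw [counit, casimir, map_mul, map_add, map_neg, map_smul, map_sub, map_smul, map_smul, map_mul,
    map_pow, map_pow, e1, e2, e3, e4, e5]
  have h0 := h.1; have h1 := h.h1; have h2 := h.h2
  have h3 : s + s⁻¹ = (s ^ 2 + 1) / s := by field_simp
  rw [h.e2, h3]
  simp
  field_simp
  ring

theorem counitR_gens : counitR s (IR.ApK s) = 0 ∧ counitR s (IR.AmK s) = 0 ∧
    counitR s (IR.KsqP s) = 1 := by
  obtain ⟨e1, e2, e3, e4, e5⟩ := lift_gens _ _ _ _ _ (counit_relations s)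
  refine ⟨?_, ?_, ?_⟩
  · change counit s (Ap s * K s) = _
    rw [counit, map_mul, e1, zero_mul]
  · change counit s (Am s * K s) = _
    rw [counit, map_mul, e2, zero_mul]
  · change counit s (K s ^ 2 * P s) = _
    rw [counit, map_mul, map_pow, e3, e5, one_pow, one_mul]

/-- The upper left entry is `s ^ 2 - s (s ^ 2 - s⁻²) / (s + s⁻¹) = s ^ 2 - (s ^ 2 - 1) = 1`. -/
theorem counitR_IRMat (h : IsGeneric s) : (counitR s).mapMatrix (IRMat s) = 1 := by
  obtain ⟨e1, e2, e3⟩ := counitR_gens (s := s)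
  have h0 := h.1; have h1 := h.h1; have h2 := h.h2
  ext i j
  fin_cases i <;> fin_cases j
  · simp [IRMat, counit_casimir h, e3]
    have h3 : s + s⁻¹ = (s ^ 2 + 1) / s := by field_simp
    rw [h3]; field_simp; ring
  · simp [IRMat, e2]
  · simp [IRMat, e1]
  · simp [IRMat, e3]

variable {W : Type*} [Ring W] [Algebra k W]

/-- Extension of a morphism by an application of the coproduct. -/
def extendCoproduct (h : IsGeneric s) (F : IR s →ₐ[k] W) : IR s →ₐ[k] Osp k s ⊗[k] W :=
  (Algebra.TensorProduct.map (AlgHom.id k (Osp k s)) F).comp (coproductR h)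

/-- Extension of a morphism by an application of the coaction. -/
def extendTau (h : IsGeneric s) (F : IR s →ₐ[k] W) : IR s →ₐ[k] Osp k s ⊗[k] W :=
  (Algebra.TensorProduct.map (AlgHom.id k (Osp k s)) F).comp (tauR h)

/-- The trivial morphism given by the counit. -/
def trivialHom (s : k) (W : Type*) [Ring W] [Algebra k W] : IR s →ₐ[k] W :=
  (Algebra.ofId k W).comp (counitR s)

theorem trivialHom_IRMat (h : IsGeneric s) : (trivialHom s W).mapMatrix (IRMat s) = 1 := by
  have : (trivialHom s W).mapMatrix (IRMat s) =
      (Algebra.ofId k W).mapMatrix ((counitR s).mapMatrix (IRMat s)) := by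
    ext i j; rfl
  rw [this, counitR_IRMat h, map_one]

theorem map_id_tmul (F : IR s →ₐ[k] W) (a : Osp k s) (v : IR s) :
    Algebra.TensorProduct.map (AlgHom.id k (Osp k s)) F (a ⊗ₜ v) = a ⊗ₜ F v := rfl

/-- The counit axiom `(id ⊗ ε) Δ = id`, with the unit of `W` in the remaining positions. -/
theorem extendCoproduct_trivialHom (h : IsGeneric s) :
    extendCoproduct h (trivialHom s W) = includeLeft.comp (IR s).val := by
  obtain ⟨e1, e2, e3⟩ := counitR_gens (s := s)
  have e4 := counit_casimir h
  obtain ⟨d1, d2, d3, d4⟩ := coproductR_gens h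
  have t1 (c : k) (a : Osp k s) : a ⊗ₜ[k] algebraMap k W c = c • (a ⊗ₜ[k] 1) := by
    rw [Algebra.algebraMap_eq_smul_one, TensorProduct.tmul_smul]
  have h0 := h.1; have h1 := h.h1; have h2 := h.h2
  have h3 : s + s⁻¹ = (s ^ 2 + 1) / s := by field_simp
  apply IR.hom_ext
  · simp [extendCoproduct, d1, map_id_tmul, trivialHom, e1, e3]; rfl
  · simp [extendCoproduct, d2, map_id_tmul, trivialHom, e2, e3]; rfl
  · simp [extendCoproduct, d3, map_id_tmul, trivialHom, e3]; rfl
  · simp only [extendCoproduct, AlgHom.comp_apply, d4, map_add, map_sub, map_smul, map_id_tmul,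
      trivialHom, e1, e2, e3, e4, Algebra.ofId_apply, map_one, map_zero, t1, h.e2, h3,
      TensorProduct.tmul_zero]
    change _ = casimir s ⊗ₜ[k] (1 : W)
    match_scalars
    · simp
    · field_simp; ring

/-- The coaction counterpart: `(id ⊗ ε) τ_R = ε`, so positions to the right of all elements of `A`
contribute nothing. -/
theorem extendTau_trivialHom (h : IsGeneric s) :
    extendTau h (trivialHom s W) = trivialHom s (Osp k s ⊗[k] W) := by
  obtain ⟨e1, e2, e3⟩ := counitR_gens (s := s)
  have e4 := counit_casimir h
  obtain ⟨d1, d2, d3, d4⟩ := tauR_spec h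
  have t1 (c : k) (a : Osp k s) : a ⊗ₜ[k] algebraMap k W c = c • (a ⊗ₜ[k] 1) := by
    rw [Algebra.algebraMap_eq_smul_one, TensorProduct.tmul_smul]
  have h0 := h.1; have h1 := h.h1; have h2 := h.h2
  have h3 : s + s⁻¹ = (s ^ 2 + 1) / s := by field_simp
  apply IR.hom_ext
  · simp only [extendTau, AlgHom.comp_apply, d2, map_add, map_sub, map_smul, map_id_tmul,
      trivialHom, e1, e2, e3, e4, Algebra.ofId_apply, map_one, map_zero, t1, h3,
      TensorProduct.tmul_zero]
    -- The two terms in `A_+ K⁻¹ P` cancel because `(s ^ 2 - s⁻²) / (s + s⁻¹) = s - s⁻¹`.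
    match_scalars
    field_simp; ring
  · simp [extendTau, d1, map_id_tmul, trivialHom, e2]
  · simp [extendTau, d3, map_id_tmul, trivialHom, e2, e3]
  · simp only [extendTau, AlgHom.comp_apply, d4, map_id_tmul, trivialHom, e4, Algebra.ofId_apply,
      t1]
    rw [Algebra.algebraMap_eq_smul_one]; rfl

/-- The matrix of the extended generators, for the coaction. -/
theorem extendTau_IRMat (h : IsGeneric s) (F : IR s →ₐ[k] W) :
    (extendTau h F).mapMatrix (IRMat s) =
      (includeLeft : Osp k s →ₐ[k] Osp k s ⊗[k] W).mapMatrix (lMatInv s) *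
      (includeRight : W →ₐ[k] Osp k s ⊗[k] W).mapMatrix (F.mapMatrix (IRMat s)) *
      (includeLeft : Osp k s →ₐ[k] Osp k s ⊗[k] W).mapMatrix (lMat s) := by
  obtain ⟨d1, d2, d3, d4⟩ := tauR_spec h
  have hs := h.1; have h1 := h.h1; have h2 := h.h2
  ext i j
  fin_cases i <;> fin_cases j <;>
    simp [extendTau, IRMat, lMat, lMatInv, Matrix.mul_apply, Fin.sum_univ_two, d1, d2, d3, d4,
      map_id_tmul]
  all_goals
    simp only [sq, mul_add, add_mul, tmul_mul_tmul, one_def,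
        mul_sub, sub_mul, smul_mul_assoc, mul_smul_comm, mul_assoc, smul_sub, smul_add, neg_mul,
        mul_neg, smul_neg, smul_smul, neg_neg, sub_neg_eq_add, mul_one, one_mul,
        KA, KM, kA hs, kM hs, PA, PM, PK, Pk, PP, MA, K_mul_Kinv, Kinv_mul_K,
        KA', KM', kA' _ hs, kM' _ hs, PA', PM', PK', Pk', PP', MA', Kk', kK',
      TensorProduct.tmul_add, TensorProduct.add_tmul, TensorProduct.tmul_sub,
      TensorProduct.sub_tmul, TensorProduct.tmul_neg, TensorProduct.neg_tmul,
      ← TensorProduct.smul_tmul', TensorProduct.tmul_smul]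
    try match_scalars <;> field_simp <;> ring

/-- The matrix of the extended generators, for the coproduct. -/
theorem extendCoproduct_IRMat (h : IsGeneric s) (F : IR s →ₐ[k] W) :
    (extendCoproduct h F).mapMatrix (IRMat s) =
      (includeLeft : Osp k s →ₐ[k] Osp k s ⊗[k] W).mapMatrix ((IR s).val.mapMatrix (IRMat s)) *
      ((includeLeft : Osp k s →ₐ[k] Osp k s ⊗[k] W).mapMatrix (lMatInv s) *
      (includeRight : W →ₐ[k] Osp k s ⊗[k] W).mapMatrix (F.mapMatrix (IRMat s)) *
      (includeLeft : Osp k s →ₐ[k] Osp k s ⊗[k] W).mapMatrix (lMat s)) := by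
  obtain ⟨d1, d2, d3, d4⟩ := coproductR_gens h
  have hs := h.1; have h1 := h.h1; have h2 := h.h2
  have v1 : (IR.KsqP s : Osp k s) = K s ^ 2 * P s := rfl
  have v2 : (IR.ApK s : Osp k s) = Ap s * K s := rfl
  have v3 : (IR.AmK s : Osp k s) = Am s * K s := rfl
  have v4 : (IR.cas s : Osp k s) = casimir s := rfl
  ext i j
  fin_cases i <;> fin_cases j <;>
    simp [extendCoproduct, IRMat, lMat, lMatInv, Matrix.mul_apply, Fin.sum_univ_two, d1, d2, d3, d4,
      map_id_tmul, v1, v2, v3, v4]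
  all_goals
    try simp only [casimir, h.e2]
    simp only [sq, mul_add, add_mul, tmul_mul_tmul, one_def, h.e1,
        mul_sub, sub_mul, smul_mul_assoc, mul_smul_comm, mul_assoc, smul_sub, smul_add, neg_mul,
        mul_neg, smul_neg, smul_smul, neg_neg, sub_neg_eq_add, mul_one, one_mul,
        KA, KM, kA hs, kM hs, PA, PM, PK, Pk, PP, MA, K_mul_Kinv, Kinv_mul_K,
        KA', KM', kA' _ hs, kM' _ hs, PA', PM', PK', Pk', PP', MA', Kk', kK',
      TensorProduct.tmul_add, TensorProduct.add_tmul, TensorProduct.tmul_sub,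
      TensorProduct.sub_tmul, TensorProduct.tmul_neg, TensorProduct.neg_tmul,
      ← TensorProduct.smul_tmul', TensorProduct.tmul_smul]
    try match_scalars <;> field_simp <;> ring

end
end

/-! ### The matrices attached to subsets, and their link with `gamma`. -/

noncomputable section
open Osp Algebra.TensorProduct

section
variable {k : Type*} [Field k] {s : k} {W : Type*} [Ring W] [Algebra k W]

theorem entriesCommute_include (X : M2 (Osp k s)) (Y : M2 W) :
    EntriesCommute ((includeLeft : Osp k s →ₐ[k] Osp k s ⊗[k] W).mapMatrix X)
      ((includeRight : W →ₐ[k] Osp k s ⊗[k] W).mapMatrix Y) := by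
  intro i j i' j'
  simp [Commute, SemiconjBy]

theorem exchange_extendTau (h : IsGeneric s) {F G : IR s →ₐ[k] W}
    (hFG : Exchange s (F.mapMatrix (IRMat s)) (G.mapMatrix (IRMat s))) :
    Exchange s ((extendTau h F).mapMatrix (IRMat s)) ((extendTau h G).mapMatrix (IRMat s)) := by
  have hL := (isLOp_lMat h).map (includeLeft : Osp k s →ₐ[k] Osp k s ⊗[k] W)
  rw [extendTau_IRMat, extendTau_IRMat]
  refine hL.exchange_conj h.1 (entriesCommute_include _ _) (entriesCommute_include _ _) ?_
  have := congrArg (map4 (includeRight : W →ₐ[k] Osp k s ⊗[k] W))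
    (show inner W (F.mapMatrix (IRMat s)) * up s (G.mapMatrix (IRMat s)) =
      up s (G.mapMatrix (IRMat s)) * inner W (F.mapMatrix (IRMat s)) from hFG)
  rwa [map_mul, map_mul, map4_inner, map4_up] at this

/-- The coproduct matrix is the local copy of `IRMat` times the dressed matrix of `F`. Each of the
two factors exchanges with the dressed matrix of `G`. -/
theorem exchange_extendCoproduct (h : IsGeneric s) {F G : IR s →ₐ[k] W}
    (hFG : Exchange s (F.mapMatrix (IRMat s)) (G.mapMatrix (IRMat s))) :
    Exchange s ((extendCoproduct h F).mapMatrix (IRMat s))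
      ((extendTau h G).mapMatrix (IRMat s)) := by
  have hL := (isLOp_lMat h).map (includeLeft : Osp k s →ₐ[k] Osp k s ⊗[k] W)
  rw [extendCoproduct_IRMat, ← extendTau_IRMat h F]
  refine Exchange.mul_left ?_ (exchange_extendTau h hFG)
  rw [extendTau_IRMat]
  exact hL.exchange_left h.1 (entriesCommute_include _ _)

theorem extendTau_mul (h : IsGeneric s) {F G H : IR s →ₐ[k] W}
    (hFG : H.mapMatrix (IRMat s) = F.mapMatrix (IRMat s) * G.mapMatrix (IRMat s)) :
    (extendTau h H).mapMatrix (IRMat s) =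
      (extendTau h F).mapMatrix (IRMat s) * (extendTau h G).mapMatrix (IRMat s) := by
  have hL := ((isLOp_lMat h).map (includeLeft : Osp k s →ₐ[k] Osp k s ⊗[k] W)).mul_inv
  rw [extendTau_IRMat, extendTau_IRMat, extendTau_IRMat, hFG, map_mul]
  simp only [mul_assoc]
  rw [← mul_assoc _ (AlgHom.mapMatrix _ (lMatInv s)), hL, one_mul]

theorem extendCoproduct_mul (h : IsGeneric s) {F G H : IR s →ₐ[k] W}
    (hFG : H.mapMatrix (IRMat s) = F.mapMatrix (IRMat s) * G.mapMatrix (IRMat s)) :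
    (extendCoproduct h H).mapMatrix (IRMat s) =
      (extendCoproduct h F).mapMatrix (IRMat s) * (extendTau h G).mapMatrix (IRMat s) := by
  rw [extendCoproduct_IRMat, extendCoproduct_IRMat, ← extendTau_IRMat h H, ← extendTau_IRMat h F,
    extendTau_mul h hFG, mul_assoc]

theorem extendTau_cas (h : IsGeneric s) (F : IR s →ₐ[k] W) :
    extendTau h F (IR.cas s) = 1 ⊗ₜ F (IR.cas s) := by
  rw [extendTau, AlgHom.comp_apply, (tauR_spec h).cas, map_id_tmul]

/-- The two contributions of `K² P` cancel in the quantum trace, which leaves only the Casimir term.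
-/
theorem qtr_mapMatrix_IRMat (F : IR s →ₐ[k] W) :
    qtr s (F.mapMatrix (IRMat s)) = (s * (s ^ 2 - (s ^ 2)⁻¹)) • F (IR.cas s) := by
  simp [qtr, IRMat]

end

variable {k : Type u} [Field k] {s : k}

/-- The right extension process for the set `A`, for the tensor positions `j, …, j + m - 1`, which
is never stopped, and finished with the counit. -/
def extend (h : IsGeneric s) (A : Finset ℕ) : (m : ℕ) → (j : ℕ) → IR s →ₐ[k] ospPow s m
  | 0, _ => counitR s
  | m + 1, j =>
    if j ∈ A then extendCoproduct h (extend h A m (j + 1))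
    else extendTau h (extend h A m (j + 1))

variable {h : IsGeneric s} {A B : Finset ℕ}

theorem extend_succ_of_mem {m j : ℕ} (hj : j ∈ A) :
    extend h A (m + 1) j = extendCoproduct h (extend h A m (j + 1)) := if_pos hj
theorem extend_succ_of_notMem {m j : ℕ} (hj : j ∉ A) :
    extend h A (m + 1) j = extendTau h (extend h A m (j + 1)) := if_neg hj

theorem extend_of_lt (m : ℕ) : ∀ j : ℕ, (∀ a ∈ A, a < j) →
    extend h A m j = trivialHom s (ospPow s m) := by
  induction m with
  | zero => intro j _; rfl
  | succ m ih =>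
    intro j hj
    rw [extend_succ_of_notMem fun hA => (hj j hA).false, ih _ fun a ha => (hj a ha).trans j.lt_succ_self]
    exact extendTau_trivialHom h

variable (h) in
/-- The matrix of the extended generators. -/
def extendMat (A : Finset ℕ) (m j : ℕ) : M2 (ospPow s m) := (extend h A m j).mapMatrix (IRMat s)

theorem extendMat_of_lt {m j : ℕ} (hj : ∀ a ∈ A, a < j) : extendMat h A m j = 1 := by
  rw [extendMat, extend_of_lt _ _ hj, trivialHom_IRMat h]

theorem isReflection_extendMat (m j : ℕ) : IsReflection s (extendMat h A m j) :=
  (isReflection_IRMat h).map _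

/-- The set containing the current position decides which step applies. Dressing is multiplicative,
and for `j ∈ A` the local factor stands on the left, where `M_A` is. -/
theorem extendMat_union (hAB : Prec A B) (m : ℕ) : ∀ j : ℕ,
    extendMat h (A ∪ B) m j = extendMat h A m j * extendMat h B m j := by
  induction m with
  | zero =>
    intro j
    have e (A : Finset ℕ) : extendMat h A 0 j = 1 := counitR_IRMat h
    rw [e, e, e, one_mul]
  | succ m ih =>
    intro j
    by_cases hB : j ∈ B
    · rw [extendMat_of_lt (A := A) fun a ha => hAB a ha j hB, one_mul, extendMat, extendMat,
        extend_succ_of_mem hB, extend_succ_of_mem (Finset.mem_union_right _ hB)]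
      have := ih (j + 1)
      rw [extendMat_of_lt (A := A) fun a ha => (hAB a ha j hB).trans j.lt_succ_self, one_mul] at this
      -- All of `A` lies below `j`, so `A ∪ B` and `B` have the same matrix from `j + 1` on. The
      -- coproduct step depends on a morphism only through its matrix.
      have e : ∀ F G : IR s →ₐ[k] ospPow s m, F.mapMatrix (IRMat s) = G.mapMatrix (IRMat s) →
          (extendCoproduct h F).mapMatrix (IRMat s) = (extendCoproduct h G).mapMatrix (IRMat s) := by
        intro F G hFG
        rw [extendCoproduct_IRMat, extendCoproduct_IRMat, hFG]
      exact e _ _ this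
    · by_cases hA : j ∈ A
      · rw [extendMat, extendMat, extendMat, extend_succ_of_mem hA, extend_succ_of_notMem hB,
          extend_succ_of_mem (Finset.mem_union_left _ hA)]
        exact extendCoproduct_mul h (ih (j + 1))
      · rw [extendMat, extendMat, extendMat, extend_succ_of_notMem hA, extend_succ_of_notMem hB,
          extend_succ_of_notMem (by simp [hA, hB])]
        exact extendTau_mul h (ih (j + 1))

theorem exchange_extendMat (hAB : Prec A B) (m : ℕ) : ∀ j : ℕ,
    Exchange s (extendMat h A m j) (extendMat h B m j) := by
  induction m with
  | zero =>
    intro j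
    have e : extendMat h A 0 j = 1 := counitR_IRMat h
    rw [e]
    exact Exchange.one_left
  | succ m ih =>
    intro j
    by_cases hB : j ∈ B
    · rw [extendMat_of_lt (A := A) fun a ha => hAB a ha j hB]
      exact Exchange.one_left
    · by_cases hA : j ∈ A
      · rw [extendMat, extendMat, extend_succ_of_mem hA, extend_succ_of_notMem hB]
        exact exchange_extendCoproduct h (ih (j + 1))
      · rw [extendMat, extendMat, extend_succ_of_notMem hA, extend_succ_of_notMem hB]
        exact exchange_extendTau h (ih (j + 1))

/-- Stopping at the last element of `A` agrees with continuing to the end: the tail is the counit,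
and one coproduct followed by it is the inclusion. `extendRight` with parameter `m` fills the `m +
1` positions `j, …, j + m`, whence `m + 1` on the right. -/
theorem extendRight_eq_extend (m : ℕ) : ∀ j : ℕ, (∃ a ∈ A, j ≤ a) → (∀ a ∈ A, a ≤ j + m) →
    extendRight h A m j = extend h A (m + 1) j := by
  induction m with
  | zero =>
    rintro j ⟨a, ha, hja⟩ hA
    obtain rfl : j = a := le_antisymm hja (hA a ha)
    rw [extend_succ_of_mem ha, extend_of_lt _ _ fun b hb => Nat.lt_succ_of_le (hA b hb)]
    exact (extendCoproduct_trivialHom h).symm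
  | succ m ih =>
    rintro j ⟨a, ha, hja⟩ hA
    by_cases hex : ∃ a ∈ A, j < a
    · have e : extendRight h A (m + 1) j =
          (Algebra.TensorProduct.map (AlgHom.id k (Osp k s)) (extendRight h A m (j + 1))).comp
            (if j ∈ A then coproductR h else tauR h) := if_pos hex
      rw [e, ih (j + 1) hex fun b hb => by have := hA b hb; lia]
      by_cases hj : j ∈ A
      · rw [extend_succ_of_mem hj, if_pos hj]; rfl
      · rw [extend_succ_of_notMem hj, if_neg hj]; rfl
    · have e : extendRight h A (m + 1) j = includeLeft.comp (IR s).val := if_neg hex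
      push Not at hex
      obtain rfl : j = a := le_antisymm hja (hex a ha)
      rw [e, extend_succ_of_mem ha, extend_of_lt _ _ fun b hb => Nat.lt_succ_of_le (hex b hb)]
      exact (extendCoproduct_trivialHom h).symm

theorem gammaFrom_eq_extend (m : ℕ) : ∀ j : ℕ, (∃ a ∈ A, j ≤ a) → (∀ a ∈ A, a < j + m) →
    gammaFrom h A m j = extend h A m j (IR.cas s) := by
  induction m with
  | zero =>
    rintro j ⟨a, ha, hja⟩ hA
    exact absurd (hA a ha) (by lia)
  | succ m ih =>
    rintro j ⟨a, ha, hja⟩ hA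
    by_cases hj : j ∈ A
    · have e : gammaFrom h A (m + 1) j = extendRight h A m j (IR.cas s) := if_pos hj
      rw [e, extendRight_eq_extend m j ⟨a, ha, hja⟩ fun b hb => by have := hA b hb; lia]
      rfl
    · have e : gammaFrom h A (m + 1) j = (1 : Osp k s) ⊗ₜ[k] gammaFrom h A m (j + 1) := if_neg hj
      have hne : j ≠ a := by rintro rfl; exact hj ha
      rw [e, ih (j + 1) ⟨a, ha, by lia⟩ fun b hb => by have := hA b hb; lia,
        extend_succ_of_notMem hj]
      exact (extendTau_cas h _).symm

/-- Leading positions outside `A` agree as well, since `τ_R` sends `Γ^q` to `1 ⊗ Γ^q`. -/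
theorem gamma_eq_extend {n : ℕ} (hA : A ⊆ Finset.Icc 1 n) :
    gamma h n A = extend h A n 1 (IR.cas s) := by
  rcases A.eq_empty_or_nonempty with rfl | ⟨a, ha⟩
  · rw [gamma, if_pos rfl, extend_of_lt _ _ (by simp), trivialHom, AlgHom.comp_apply,
      counit_casimir h]
    rfl
  · rw [gamma, if_neg (Finset.ne_empty_of_mem ha)]
    refine gammaFrom_eq_extend n 1 ⟨a, ha, (Finset.mem_Icc.1 (hA ha)).1⟩ fun b hb => ?_
    have := (Finset.mem_Icc.1 (hA hb)).2
    lia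

theorem qtr_extendMat {n : ℕ} (hA : A ⊆ Finset.Icc 1 n) :
    qtr s (extendMat h A n 1) = (s * (s ^ 2 - (s ^ 2)⁻¹)) • gamma h n A := by
  rw [gamma_eq_extend hA, extendMat, qtr_mapMatrix_IRMat]

/-- Cancellation of the normalisation of the quantum trace. -/
theorem qAnticomm_of_smul {B : Type*} [Ring B] [Algebra k B] {r : k} (hr : r ≠ 0)
    {X Y Z V₁ V₂ U₁ U₂ : B}
    (e : qAnticomm s (r • X) (r • Y) =
      r • r • Z + (s + s⁻¹) • (r • V₁ * r • V₂ + r • U₁ * r • U₂)) :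
    qAnticomm s X Y = Z + (s + s⁻¹) • (V₁ * V₂ + U₁ * U₂) := by
  have e' : (r * r) • qAnticomm s X Y =
      (r * r) • (Z + (s + s⁻¹) • (V₁ * V₂ + U₁ * U₂)) := by
    rw [qAnticomm] at e ⊢
    simp only [smul_mul_assoc, mul_smul_comm] at e
    calc _ = s • r • r • (X * Y) + s⁻¹ • r • r • (Y * X) := by module
      _ = _ := e
      _ = _ := by module
  exact smul_right_injective B (mul_ne_zero hr hr) e'

end
end QBI

/-! ### The higher rank relations. -/

theorem theorem8p3 {k : Type*} [Field k] {s : k} (hs : QBI.IsGeneric s) (n : ℕ)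
    (A₁ A₂ A₃ A₄ : Finset ℕ)
    (h₁ : A₁ ⊆ Finset.Icc 1 n) (h₂ : A₂ ⊆ Finset.Icc 1 n)
    (h₃ : A₃ ⊆ Finset.Icc 1 n) (h₄ : A₄ ⊆ Finset.Icc 1 n)
    (h₁₂ : QBI.Prec A₁ A₂) (h₁₃ : QBI.Prec A₁ A₃) (h₁₄ : QBI.Prec A₁ A₄)
    (h₂₃ : QBI.Prec A₂ A₃) (h₂₄ : QBI.Prec A₂ A₄) (h₃₄ : QBI.Prec A₃ A₄)
    (A B : Finset ℕ)
    (hAB : (A = A₁ ∪ A₂ ∪ A₄ ∧ B = A₂ ∪ A₃) ∨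
      (A = A₂ ∪ A₃ ∧ B = A₁ ∪ A₃ ∪ A₄) ∨
      (A = A₁ ∪ A₃ ∪ A₄ ∧ B = A₁ ∪ A₂ ∪ A₄)) :
    QBI.qAnticomm s (QBI.gamma hs n A) (QBI.gamma hs n B) =
      QBI.gamma hs n ((A ∪ B) \ (A ∩ B)) +
        (s + s⁻¹) •
          (QBI.gamma hs n (A ∩ B) * QBI.gamma hs n (A ∪ B) +
            QBI.gamma hs n (A \ (A ∩ B)) * QBI.gamma hs n (B \ (A ∩ B))) := by
  open QBI in
  -- The normalisation `r` of the quantum trace is nonzero because `q ^ 2 ≠ 1`.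
  have hr : s * (s ^ 2 - (s ^ 2)⁻¹) ≠ 0 := by
    refine mul_ne_zero hs.1 fun h => ?_
    have h0 := hs.1
    field_simp at h
    exact mul_ne_zero hs.h1 hs.h2 (by linear_combination h)
  have union {A B C : Finset ℕ} (hA : Prec A C) (hB : Prec B C) : Prec (A ∪ B) C := by
    intro a ha c hc
    rcases Finset.mem_union.1 ha with ha | ha
    exacts [hA a ha c hc, hB a ha c hc]
  have ne {A B : Finset ℕ} (hAB : Prec A B) {x : ℕ} (ha : x ∈ A) (hb : x ∈ B) : False :=
    (hAB x ha x hb).false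
  have x₁₂ := exchange_extendMat (h := hs) h₁₂ n 1
  have x₁₃ := exchange_extendMat (h := hs) h₁₃ n 1
  have x₁₄ := exchange_extendMat (h := hs) h₁₄ n 1
  have x₂₃ := exchange_extendMat (h := hs) h₂₃ n 1
  have x₂₄ := exchange_extendMat (h := hs) h₂₄ n 1
  have x₃₄ := exchange_extendMat (h := hs) h₃₄ n 1
  have q₂ := qtr_extendMat (h := hs) h₂
  have q₃ := qtr_extendMat (h := hs) h₃
  have q₁₄ := qtr_extendMat (h := hs) (Finset.union_subset h₁ h₄)
  have q₂₃ := qtr_extendMat (h := hs) (Finset.union_subset h₂ h₃)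
  have q₁₂₄ := qtr_extendMat (h := hs) (Finset.union_subset (Finset.union_subset h₁ h₂) h₄)
  have q₁₃₄ := qtr_extendMat (h := hs) (Finset.union_subset (Finset.union_subset h₁ h₃) h₄)
  have q := qtr_extendMat (h := hs)
    (Finset.union_subset (Finset.union_subset (Finset.union_subset h₁ h₂) h₃) h₄)
  rw [extendMat_union h₁₄] at q₁₄
  rw [extendMat_union h₂₃] at q₂₃
  rw [extendMat_union (union h₁₄ h₂₄), extendMat_union h₁₂] at q₁₂₄
  rw [extendMat_union (union h₁₄ h₃₄), extendMat_union h₁₃] at q₁₃₄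
  rw [extendMat_union (union (union h₁₄ h₂₄) h₃₄), extendMat_union (union h₁₃ h₂₃),
    extendMat_union h₁₂] at q
  -- After multiplication by `r ^ 2`, each `r • Γ` is a quantum trace. In the linear term, the
  -- second factor `r` is the coefficient in the skein relation.
  apply qAnticomm_of_smul hr
  rcases hAB with ⟨rfl, rfl⟩ | ⟨rfl, rfl⟩ | ⟨rfl, rfl⟩
  -- The ordering makes the blocks disjoint, so intersections and differences are again unions of
  -- blocks.
  · have e1 : (A₁ ∪ A₂ ∪ A₄) ∩ (A₂ ∪ A₃) = A₂ := by grind [Prec]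
    have e2 : (A₁ ∪ A₂ ∪ A₄) ∪ (A₂ ∪ A₃) = A₁ ∪ A₂ ∪ A₃ ∪ A₄ := by grind
    have e3 : (A₁ ∪ A₂ ∪ A₃ ∪ A₄) \ A₂ = A₁ ∪ A₃ ∪ A₄ := by grind [Prec]
    have e4 : (A₁ ∪ A₂ ∪ A₄) \ A₂ = A₁ ∪ A₄ := by grind [Prec]
    have e5 : (A₂ ∪ A₃) \ A₂ = A₃ := by grind [Prec]
    rw [e1, e2, e3, e4, e5, ← q₂, ← q₃, ← q₁₄, ← q₂₃, ← q₁₂₄, ← q₁₃₄, ← q]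
    exact skein_one hs.1 (isReflection_extendMat n 1) x₁₂ x₁₃ x₂₃ x₂₄ x₃₄
  · have e1 : (A₂ ∪ A₃) ∩ (A₁ ∪ A₃ ∪ A₄) = A₃ := by grind [Prec]
    have e2 : (A₂ ∪ A₃) ∪ (A₁ ∪ A₃ ∪ A₄) = A₁ ∪ A₂ ∪ A₃ ∪ A₄ := by grind
    have e3 : (A₁ ∪ A₂ ∪ A₃ ∪ A₄) \ A₃ = A₁ ∪ A₂ ∪ A₄ := by grind [Prec]
    have e4 : (A₂ ∪ A₃) \ A₃ = A₂ := by grind [Prec]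
    have e5 : (A₁ ∪ A₃ ∪ A₄) \ A₃ = A₁ ∪ A₄ := by grind [Prec]
    rw [e1, e2, e3, e4, e5, ← q₂, ← q₃, ← q₁₄, ← q₂₃, ← q₁₂₄, ← q₁₃₄, ← q]
    exact skein_two hs.1 (isReflection_extendMat n 1) x₁₂ x₁₃ x₂₃ x₂₄ x₃₄
  · have e1 : (A₁ ∪ A₃ ∪ A₄) ∩ (A₁ ∪ A₂ ∪ A₄) = A₁ ∪ A₄ := by grind [Prec]
    have e2 : (A₁ ∪ A₃ ∪ A₄) ∪ (A₁ ∪ A₂ ∪ A₄) = A₁ ∪ A₂ ∪ A₃ ∪ A₄ := by grind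
    have e3 : (A₁ ∪ A₂ ∪ A₃ ∪ A₄) \ (A₁ ∪ A₄) = A₂ ∪ A₃ := by grind [Prec]
    have e4 : (A₁ ∪ A₃ ∪ A₄) \ (A₁ ∪ A₄) = A₃ := by grind [Prec]
    have e5 : (A₁ ∪ A₂ ∪ A₄) \ (A₁ ∪ A₄) = A₂ := by grind [Prec]
    rw [e1, e2, e3, e4, e5, ← q₂, ← q₃, ← q₁₄, ← q₂₃, ← q₁₂₄, ← q₁₃₄, ← q]
    exact skein_three hs.1 (isReflection_extendMat n 1) (isReflection_extendMat n 1)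
      x₁₂ x₁₃ x₁₄ x₂₃ x₂₄ x₃₄
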